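/- Let $k\ge 2$ and let $G$ be a $k$-uniform hypergraph: a finite vertex set $V(G)$ with a set $E(G)$ of edges, each a set of exactly $k$ vertices. Its size is $|E(G)|$, and the degree $d_i$ of a vertex $i$ is the number of edges containing $i$. The ABC tensor of $G$ is the real tensor of order $k$ with entries, for $i_1,\dots,i_k\in V(G)$, $$\mathcal{ABC}(G)_{i_1,\dots,i_k}=\begin{cases}\dfrac{1}{(k-1)!}\sqrt[k]{\dfrac{\sum_{i\in e}d_i-k}{\prod_{i\in e}d_i}} & \text{if } e=\{i_1,\dots,i_k\}\in E(G),\\ 0 & \text{otherwise.}\end{cases}$$ A complex number $\lambda$ is an eigenvalue of a tensor $\mathcal T$ of order $k$ if there is a complex vector $x\neq 0$ with $\sum_{i_2,\dots,i_k}\mathcal T_{i,i_2,\dots,i_k}x_{i_2}\cdots x_{i_k}=\lambda x_i^{k-1}$ for all $i$. The ABC spectral radius $\rho_{ABC}(G)$ is the maximum modulus of the eigenvalues of $\mathcal{ABC}(G)$. A path from $u$ to $w$ consists of distinct vertices $v_1=u,\dots,v_{\ell+1}=w$ and distinct edges $e_1,\dots,e_\ell$ ($\ell\ge 0$) with $\{v_i,v_{i+1}\}\subseteq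 e_i$ for all $i$ and $e_i\cap e_j=\emptyset$ for $j>i+1$. $G$ is connected if any two vertices are joined by a path. A cycle consists, for some $\ell\ge 2$, of distinct vertices $v_1,\dots,v_\ell$ and distinct edges $e_1,\dots,e_\ell$ with $\{v_i,v_{i+1}\}\subseteq e_i$ for all $i$ and $e_i\cap e_j=\emptyset$ whenever $i\ne j$ are not consecutive, indices being modulo $\ell$. A hypertree is a connected hypergraph without cycles. Let $S_{m,k}$ be the $k$-uniform hyperstar with $m$ edges: all edges contain a common vertex, the center, and are otherwise pairwise disjoint. For $m\ge 3$, let $D_{m,1}$ be the ordinary tree obtained by adding an edge between the centers of two disjoint stars $S_{1,2}$ and $S_{m-2,2}$, and let $D_{m,1}^k$ be its $k$-th power, obtained by adding to every edge $k-2$ new vertices that belong to that edge only (so $D_{m,1}^2=D_{m,1}$). **Theorem.** Let $k\ge 2$, and let $G$ be a $k$-uniform hypertree of size $m\ge 1$. Then $$\rho_{ABC}(G)\le\sqrt[k]{m-1},$$ with equality if and only if $G\cong S_{m,k}$. Moreover, if $G\not\cong S_{m,k}$ (which forces $m\ge 3$), then $$\rho_{ABC}(G)\le\sqrt[k]{\frac{m^2-3m+3+\sqrt{(m-1)^2+(m-2)^4}}{2(m-1)}},$$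 with equality if and only if $G\cong D_{m,1}^k$. -/

import Mathlib

/-- A `k`-uniform hypergraph whose (finite) vertex set is the type `V`: a set of edges, each of
which is a set of exactly `k` vertices. -/
structure UniformHypergraph (V : Type*) (k : ℕ) where
  edges : Finset (Finset V)
  card_edge : ∀ e ∈ edges, e.card = k

namespace UniformHypergraph

/-- The size of a hypergraph is its number of edges. -/
def size {V : Type*} {k : ℕ} (G : UniformHypergraph V k) : ℕ := G.edges.card

/-- The degree of a vertex is the number of edges containing it. -/
def degree {V : Type*} [DecidableEq V] {k : ℕ} (G : UniformHypergraph V k) (v : V) : ℕ :=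
  (G.edges.filter (fun e => v ∈ e)).card

/-- Isomorphism of hypergraphs: a bijection of the vertex sets that carries edges exactly to
edges. -/
def Isomorphic {V W : Type*} {k : ℕ} (G : UniformHypergraph V k) (H : UniformHypergraph W k) :
    Prop :=
  ∃ φ : V ≃ W, ∀ e : Finset V, e.map φ.toEmbedding ∈ H.edges ↔ e ∈ G.edges

/-- The vertices `v 0, …, v ℓ` (distinct) and the edges `e 0, …, e (ℓ - 1)` (distinct) form a
path of length `ℓ` in `G`: `e i` contains `v i` and `v (i + 1)`, and edges that are not
consecutive are disjoint. -/
def IsPath {V : Type*} {k : ℕ} (G : UniformHypergraph V k) {ℓ : ℕ}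
    (v : Fin (ℓ + 1) → V) (e : Fin ℓ → Finset V) : Prop :=
  Function.Injective v ∧ Function.Injective e ∧
    (∀ i, e i ∈ G.edges) ∧
    (∀ i : Fin ℓ, v i.castSucc ∈ e i ∧ v i.succ ∈ e i) ∧
    (∀ i j : Fin ℓ, (i : ℕ) + 1 < (j : ℕ) → Disjoint (e i) (e j))

/-- Any two vertices are joined by a path (of length `0` if they coincide). -/
def Connected {V : Type*} {k : ℕ} (G : UniformHypergraph V k) : Prop :=
  ∀ u w : V, ∃ (ℓ : ℕ) (v : Fin (ℓ + 1) → V) (e : Fin ℓ → Finset V),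
    G.IsPath v e ∧ v 0 = u ∧ v (Fin.last ℓ) = w

/-- The vertices `v 0, …, v (n + 1)` (distinct) and the edges `e 0, …, e (n + 1)` (distinct) form
a cycle of length `n + 2 ≥ 2` in `G`: `e i` contains `v i` and `v (i + 1)`, and edges that are not
cyclically consecutive are disjoint. Indices are taken modulo `n + 2`: addition in `Fin (n + 2)`
wraps around. -/
def IsCycle {V : Type*} {k : ℕ} (G : UniformHypergraph V k) {n : ℕ}
    (v : Fin (n + 2) → V) (e : Fin (n + 2) → Finset V) : Prop :=
  Function.Injective v ∧ Function.Injective e ∧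
    (∀ i, e i ∈ G.edges) ∧
    (∀ i, v i ∈ e i ∧ v (i + 1) ∈ e i) ∧
    (∀ i j, i ≠ j → j ≠ i + 1 → i ≠ j + 1 → Disjoint (e i) (e j))

/-- A hypertree is a connected hypergraph without cycles. -/
def IsHypertree {V : Type*} {k : ℕ} (G : UniformHypergraph V k) : Prop :=
  G.Connected ∧
    ∀ (n : ℕ) (v : Fin (n + 2) → V) (e : Fin (n + 2) → Finset V), ¬ G.IsCycle v e

/-- The `j`-th edge of the hyperstar: the center `none` and `k - 1` vertices of its own. -/
def starEdge (m k : ℕ) (j : Fin m) : Finset (Option (Fin m × Fin (k - 1))) :=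
  insert none (Finset.univ.image (fun l : Fin (k - 1) => some (j, l)))

theorem card_starEdge (m k : ℕ) (hk : 1 ≤ k) (j : Fin m) : (starEdge m k j).card = k := by
  unfold starEdge
  rw [Finset.card_insert_of_notMem (by simp), Finset.card_image_of_injective, Finset.card_univ,
    Fintype.card_fin]
  · omega
  · intro a b h
    simpa using h

/-- The `k`-uniform hyperstar `S_{m,k}`: `m` edges that share the center `none` and nothing
else. -/
def hyperstar (m k : ℕ) (hk : 1 ≤ k) :
    UniformHypergraph (Option (Fin m × Fin (k - 1))) k where
  edges := Finset.univ.image (starEdge m k)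
  card_edge := by
    intro e he
    obtain ⟨j, -, rfl⟩ := Finset.mem_image.1 he
    exact card_starEdge m k hk j

/-- The double star `D_{m,a}`: the disjoint union of the ordinary stars `S_{a,2}` and
`S_{m-1-a,2}`, together with an edge between the two centers
(meaningful for `m ≥ 3` and `1 ≤ a ≤ (m - 1) / 2`). -/
def doubleStar (m a : ℕ) :
    UniformHypergraph
      (Option (Fin a × Fin (2 - 1)) ⊕ Option (Fin (m - 1 - a) × Fin (2 - 1))) 2 where
  edges :=
    (hyperstar a 2 one_le_two).edges.image (fun e => e.map Function.Embedding.inl) ∪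
      (hyperstar (m - 1 - a) 2 one_le_two).edges.image (fun e => e.map Function.Embedding.inr) ∪
      {{Sum.inl none, Sum.inr none}}
  card_edge := by
    intro e he
    rw [Finset.mem_union, Finset.mem_union, Finset.mem_image, Finset.mem_image,
      Finset.mem_singleton] at he
    rcases he with (⟨f, hf, rfl⟩ | ⟨f, hf, rfl⟩) | rfl
    · rw [Finset.card_map]
      exact (hyperstar _ 2 one_le_two).card_edge f hf
    · rw [Finset.card_map]
      exact (hyperstar _ 2 one_le_two).card_edge f hf
    · exact Finset.card_pair (by simp)

/-- The edge of the `k`-th power that arises from the edge `e` of `G`: the vertices of `e` and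
`k - r` new vertices `(e, 0), …, (e, k - r - 1)` that belong to `e` alone. -/
def powerEdge {V : Type*} {r : ℕ} (G : UniformHypergraph V r) (k : ℕ) (e : {e // e ∈ G.edges}) :
    Finset (V ⊕ ({e // e ∈ G.edges} × Fin (k - r))) :=
  e.1.disjSum (Finset.univ.map ⟨fun l => (e, l), fun _ _ h => (Prod.mk.inj h).2⟩)

/-- The `k`-th power `G^k` of an `r`-uniform hypergraph `G`, for `k ≥ r`. For `k = r` no vertices
are added, so that `G^r` is `G`. -/
def power {V : Type*} [DecidableEq V] {r : ℕ} (G : UniformHypergraph V r) (k : ℕ) (h : r ≤ k) :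
    UniformHypergraph (V ⊕ ({e // e ∈ G.edges} × Fin (k - r))) k where
  edges := Finset.univ.image (G.powerEdge k)
  card_edge := by
    intro e he
    obtain ⟨f, -, rfl⟩ := Finset.mem_image.1 he
    rw [powerEdge, Finset.card_disjSum, Finset.card_map, Finset.card_univ, Fintype.card_fin,
      G.card_edge f.1 f.2]
    omega

end UniformHypergraph

/-- A real tensor of order `k ≥ 1` with indices in `V`. The entry `T_{i₁, i₂, …, i_k}` is
`T i₁ f`, where `f` is the family `(i₂, …, i_k)` of the remaining `k - 1` indices. -/
abbrev HyperTensor (V : Type*) (k : ℕ) := V → (Fin (k - 1) → V) → ℝ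

namespace HyperTensor

/-- The vector `T x^{k-1}`, with entries `∑_{i₂, …, i_k} T_{i, i₂, …, i_k} x_{i₂} ⋯ x_{i_k}`. -/
def apply {V : Type*} [Fintype V] {k : ℕ} (T : HyperTensor V k) (x : V → ℂ) (i : V) : ℂ :=
  ∑ f : Fin (k - 1) → V, (T i f : ℂ) * ∏ l, x (f l)

/-- A complex number `μ` is an eigenvalue of `T` if `T x^{k-1} = μ x^{[k-1]}` for some complex
vector `x ≠ 0`. -/
def IsEigenvalue {V : Type*} [Fintype V] {k : ℕ} (T : HyperTensor V k) (μ : ℂ) : Prop :=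
  ∃ x : V → ℂ, x ≠ 0 ∧ ∀ i, T.apply x i = μ * x i ^ (k - 1)

/-- The spectral radius of `T`: the maximum modulus of its eigenvalues. It is written as a
supremum; `isGreatest_spectralRadius` shows that it is a maximum whenever there is an
eigenvalue. -/
noncomputable def spectralRadius {V : Type*} [Fintype V] {k : ℕ} (T : HyperTensor V k) : ℝ :=
  sSup {r : ℝ | ∃ μ : ℂ, T.IsEigenvalue μ ∧ ‖μ‖ = r}

theorem apply_smul {V : Type*} [Fintype V] {k : ℕ} (T : HyperTensor V k) (c : ℂ) (x : V → ℂ)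
    (i : V) : T.apply (c • x) i = c ^ (k - 1) * T.apply x i := by
  unfold apply
  rw [Finset.mul_sum]
  refine Finset.sum_congr rfl fun f _ => ?_
  simp only [Pi.smul_apply, smul_eq_mul, Finset.prod_mul_distrib, Finset.prod_const,
    Finset.card_univ, Fintype.card_fin]
  ring

theorem isGreatest_spectralRadius {V : Type*} [Fintype V] {k : ℕ} (T : HyperTensor V k)
    (h : ∃ μ : ℂ, T.IsEigenvalue μ) :
    IsGreatest {r : ℝ | ∃ μ : ℂ, T.IsEigenvalue μ ∧ ‖μ‖ = r} T.spectralRadius := by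
  let K : Set (ℂ × (V → ℂ)) :=
    {p | ‖p.2‖ = 1} ∩ {p | ∀ i, T.apply p.2 i = p.1 * p.2 i ^ (k - 1)}
  have hclosed : IsClosed K := by
    refine IsClosed.inter (isClosed_eq (by fun_prop) (by fun_prop)) ?_
    rw [Set.ofPred_forall]
    refine isClosed_iInter fun i => isClosed_eq ?_ (by fun_prop)
    unfold apply
    fun_prop
  have hbdd : Bornology.IsBounded K := by
    refine (Metric.isBounded_closedBall (x := (0 : ℂ × (V → ℂ)))
      (r := max 1 (∑ i, ∑ f, |T i f|))).subset ?_
    rintro ⟨μ, x⟩ ⟨hx, he⟩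
    have hx : ‖x‖ = 1 := hx
    have he : ∀ i, T.apply x i = μ * x i ^ (k - 1) := he
    have hV : Nonempty V := by
      by_contra hV
      rw [not_nonempty_iff] at hV
      have : x = 0 := Subsingleton.elim _ _
      rw [this, norm_zero] at hx
      exact zero_ne_one hx
    obtain ⟨i, hi⟩ : ∃ i, ‖x i‖ = 1 := by
      obtain ⟨i, hi⟩ := Finite.exists_max (fun i => ‖x i‖)
      refine ⟨i, le_antisymm (hx ▸ norm_le_pi_norm x i) ?_⟩
      rw [← hx]
      exact (pi_norm_le_iff_of_nonneg (norm_nonneg _)).2 hi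
    have hle : ∀ j, ‖x j‖ ≤ 1 := fun j => hx ▸ norm_le_pi_norm x j
    have hμ : ‖μ‖ ≤ ∑ i, ∑ f, |T i f| := by
      have h1 : ‖μ‖ = ‖T.apply x i‖ := by rw [he i]; simp [hi]
      rw [h1]
      calc ‖T.apply x i‖ ≤ ∑ f, |T i f| := by
            unfold apply
            refine (norm_sum_le _ _).trans (Finset.sum_le_sum fun f _ => ?_)
            rw [norm_mul, norm_prod, Complex.norm_real, Real.norm_eq_abs]
            refine mul_le_of_le_one_right (abs_nonneg _) ?_
            exact Finset.prod_le_one (fun _ _ => norm_nonneg _) fun l _ => hle _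
        _ ≤ _ := Finset.single_le_sum (f := fun i => ∑ f, |T i f|)
            (fun i _ => Finset.sum_nonneg fun f _ => abs_nonneg _) (Finset.mem_univ i)
    rw [mem_closedBall_zero_iff, Prod.norm_def]
    exact max_le (hμ.trans (le_max_right _ _)) (hx.le.trans (le_max_left _ _))
  have hcompact : IsCompact K := Metric.isCompact_of_isClosed_isBounded hclosed hbdd
  have himage : {r : ℝ | ∃ μ : ℂ, T.IsEigenvalue μ ∧ ‖μ‖ = r} = (fun p => ‖p.1‖) '' K := by
    ext r
    constructor
    · rintro ⟨μ, ⟨x, hx, he⟩, rfl⟩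
      have hn : ‖x‖ ≠ 0 := norm_ne_zero_iff.2 hx
      refine ⟨(μ, ((‖x‖ : ℂ)⁻¹) • x), ⟨?_, fun i => ?_⟩, rfl⟩
      · change ‖((‖x‖ : ℂ)⁻¹) • x‖ = 1
        rw [norm_smul, norm_inv, Complex.norm_real, norm_norm, inv_mul_cancel₀ hn]
      · change T.apply (((‖x‖ : ℂ)⁻¹) • x) i = μ * (((‖x‖ : ℂ)⁻¹) • x) i ^ (k - 1)
        rw [apply_smul, he i, Pi.smul_apply, smul_eq_mul, mul_pow]
        ring
    · rintro ⟨⟨μ, x⟩, ⟨hx, he⟩, rfl⟩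
      refine ⟨μ, ⟨x, ?_, he⟩, rfl⟩
      rintro rfl
      have hx : ‖(0 : V → ℂ)‖ = 1 := hx
      rw [norm_zero] at hx
      exact zero_ne_one hx
  unfold spectralRadius
  rw [himage]
  refine (hcompact.image (by fun_prop)).isGreatest_sSup ?_
  rw [← himage]
  obtain ⟨μ, hμ⟩ := h
  exact ⟨‖μ‖, μ, hμ, rfl⟩

end HyperTensor

namespace UniformHypergraph

/-- The weight `((∑_{i ∈ e} d_i - k) / ∏_{i ∈ e} d_i)^{1/k}` of an edge `e`. -/
noncomputable def abcWeight {V : Type*} [DecidableEq V] {k : ℕ} (G : UniformHypergraph V k)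
    (e : Finset V) : ℝ :=
  (((∑ i ∈ e, (G.degree i : ℝ)) - k) / ∏ i ∈ e, (G.degree i : ℝ)) ^ (1 / (k : ℝ))

/-- The ABC tensor of `G`. The set of all indices of the entry `(i, f)` is `{i} ∪ range f`. -/
noncomputable def abcTensor {V : Type*} [DecidableEq V] {k : ℕ} (G : UniformHypergraph V k) :
    HyperTensor V k :=
  fun i f =>
    if insert i (Finset.univ.image f) ∈ G.edges then
      1 / ((k - 1).factorial : ℝ) * G.abcWeight (insert i (Finset.univ.image f))
    else 0

/-- The ABC spectral radius of `G`: the spectral radius of its ABC tensor. -/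
noncomputable def abcSpectralRadius {V : Type*} [Fintype V] [DecidableEq V] {k : ℕ}
    (G : UniformHypergraph V k) : ℝ :=
  G.abcTensor.spectralRadius

/-- The ABC tensor has an eigenvalue, so that the ABC spectral radius is indeed the maximum
modulus of an eigenvalue. -/
theorem exists_isEigenvalue_abcTensor {V : Type*} [Fintype V] [DecidableEq V] [Nonempty V]
    {k : ℕ} (hk : 2 ≤ k) (G : UniformHypergraph V k) :
    ∃ μ : ℂ, G.abcTensor.IsEigenvalue μ := by
  rcases hk.eq_or_lt with rfl | hk
  · let A : (V → ℂ) →ₗ[ℂ] (V → ℂ) :=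
      { toFun := fun x i => G.abcTensor.apply x i
        map_add' := by
          intro x y
          ext i
          simp [HyperTensor.apply, mul_add, Finset.sum_add_distrib]
        map_smul' := by
          intro c x
          ext i
          rw [HyperTensor.apply_smul]
          simp }
    obtain ⟨μ, hμ⟩ := Module.End.exists_eigenvalue A
    obtain ⟨x, hx⟩ := hμ.exists_hasEigenvector
    refine ⟨μ, x, hx.2, fun i => ?_⟩
    have := congrFun hx.apply_eq_smul i
    simpa [A] using this
  · obtain ⟨v⟩ := ‹Nonempty V›
    refine ⟨0, Pi.single v 1, by simp, fun i => ?_⟩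
    rw [zero_mul, HyperTensor.apply]
    refine Finset.sum_eq_zero fun f _ => ?_
    by_cases he : insert i (Finset.univ.image f) ∈ G.edges
    · have hc := G.card_edge _ he
      have hinj : Function.Injective f := by
        have h1 := Finset.card_insert_le i (Finset.univ.image f)
        have h2 := Finset.card_image_le (s := Finset.univ) (f := f)
        rw [Finset.card_univ, Fintype.card_fin] at h2
        have h3 : Set.InjOn f (Finset.univ : Finset (Fin (k - 1))) := by
          refine Finset.card_image_iff.1 ?_
          rw [Finset.card_univ, Fintype.card_fin]
          omega
        intro a b hab
        exact h3 (by simp) (by simp) hab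
      have : ∃ l, f l ≠ v := by
        by_contra! hall
        have h01 := @hinj ⟨0, by omega⟩ ⟨1, by omega⟩ (by rw [hall, hall])
        simp at h01
      obtain ⟨l, hl⟩ := this
      rw [Finset.prod_eq_zero (Finset.mem_univ l) (Pi.single_eq_of_ne hl _), mul_zero]
    · simp [abcTensor, he]

end UniformHypergraph

/-! The proof bounds eigenvalues by labelling incidences. Give each pair `i ∈ e` a label `C i e > 0`
so that the labels at `i` add up to at most `d_i`, and `∑_{i∈e} (d_i - 1) ≤ r ∏_{i∈e} C i e` on
every edge. Multiplying the eigenvalue equation at `i` by `x_i`, summing over `i` and applying AM-GM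
on each edge gives `|μ|^k ≤ r` (`norm_eigenvalue_le_of_labelling`). For connected `G`, equality
forces equality in every edge condition. Conversely, if all conditions are equalities and the labels
are consistent (`C i e * y i` depends on `e` only), then `x_i^k = d_i y_i` defines a positive
eigenvector for `r^{1/k}` (`le_abcSpectralRadius_of_labelling`).

In a hypertree two edges share at most one vertex, so `∑_{i∈e} (d_i - 1)` is the number of edges
meeting `e`, which is at most `m - 1`. Constant labels `1` give the first bound; equality means that
all edges meet pairwise, and then they share a vertex because there are no triangles.

For the second bound let `r = secondRadius m`, and let `e` be an edge meeting as many others as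
possible. If `e` meets all others, these are pendant. Labels `1` at their free vertices and `a/r` at
an attaching vertex of degree `1 + a` make their conditions equalities, leaving `pendantFactor r a =
1 + a - a²/r` for `e`. It remains to minimise a product of such factors with `∑ a = m - 1` and no `a
= m - 1`: the minimum is at `1, m - 2, 0, …, 0`, the double star, and `r` is the root that makes the
condition at `e` an equality there (`le_prod_pendantFactor`). If `e` misses exactly one edge, that
edge hangs from one of the others; the labelling is adapted, and the condition at `e` becomes strict
(`lt_mul_prod_pendantFactor`). If every edge meets at most `m - 3` others, constant labels suffice,
since `r > m - 5/2`. -/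

/-! ### The ABC tensor as a sum over edges -/

/-- The functions `Fin n → V` whose image is a given set of `n` elements are `n!` in number. -/
theorem card_filter_image_eq {V : Type*} [Fintype V] [DecidableEq V] {n : ℕ} (S : Finset V)
    (hS : S.card = n) :
    (Finset.univ.filter (fun f : Fin n → V => Finset.univ.image f = S)).card = n.factorial := by
  have hc : Fintype.card (Fin n ≃ S) = n.factorial := by
    have e : Fin n ≃ S := Fintype.equivOfCardEq (by simp [hS])
    rw [Fintype.card_equiv e, Fintype.card_fin]
  rw [← hc, ← Finset.card_univ]
  symm
  refine Finset.card_bij (fun σ _ l => (σ l : V)) ?_ ?_ ?_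
  · intro σ _
    rw [Finset.mem_filter]
    refine ⟨Finset.mem_univ _, ?_⟩
    ext x
    simp only [Finset.mem_image, Finset.mem_univ, true_and]
    constructor
    · rintro ⟨l, rfl⟩
      exact (σ l).2
    · intro hx
      exact ⟨σ.symm ⟨x, hx⟩, by simp⟩
  · intro σ _ τ _ h
    ext l
    exact congrFun h l
  · intro f hf
    have hf : Finset.univ.image f = S := (Finset.mem_filter.1 hf).2
    have hmem : ∀ l, f l ∈ S := fun l => hf ▸ Finset.mem_image_of_mem f (Finset.mem_univ l)
    have hinj : Function.Injective f := by
      have : Set.InjOn f (Finset.univ : Finset (Fin n)) := by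
        refine Finset.card_image_iff.1 ?_
        rw [hf, hS, Finset.card_univ, Fintype.card_fin]
      intro a b hab
      exact this (by simp) (by simp) hab
    have hbij : Function.Bijective (fun l => (⟨f l, hmem l⟩ : S)) := by
      rw [Fintype.bijective_iff_injective_and_card]
      refine ⟨fun a b hab => hinj (congrArg Subtype.val hab), by simp [hS]⟩
    exact ⟨Equiv.ofBijective _ hbij, Finset.mem_univ _, rfl⟩

theorem prod_eq_prod_of_image_eq {V : Type*} [DecidableEq V] {n : ℕ} {S : Finset V}
    (hS : S.card = n) {f : Fin n → V} (hf : Finset.univ.image f = S) (x : V → ℂ) :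
    ∏ l, x (f l) = ∏ j ∈ S, x j := by
  have : Set.InjOn f (Finset.univ : Finset (Fin n)) := by
    refine Finset.card_image_iff.1 ?_
    rw [hf, hS, Finset.card_univ, Fintype.card_fin]
  rw [← hf, Finset.prod_image this]

namespace UniformHypergraph

/-- The ABC tensor applied to a vector, as a sum over the edges. -/
theorem abcTensor_apply {V : Type*} [Fintype V] [DecidableEq V] {k : ℕ} (hk : 2 ≤ k) (G : UniformHypergraph V k) (x : V → ℂ) (i : V) :
    G.abcTensor.apply x i =
      ∑ e ∈ G.edges.filter (fun e => i ∈ e), (G.abcWeight e : ℂ) * ∏ j ∈ e.erase i, x j := by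
  have hins : ∀ e ∈ G.edges.filter (fun e => i ∈ e), ∀ f : Fin (k - 1) → V,
      insert i (Finset.univ.image f) = e ↔ Finset.univ.image f = e.erase i := by
    intro e he f
    obtain ⟨he, hi⟩ := Finset.mem_filter.1 he
    constructor
    · intro h
      -- The `k - 1` values of `f` cannot fill an edge of `k` vertices.
      have hni : i ∉ Finset.univ.image f := by
        intro hmem
        have h1 := Finset.card_image_le (s := Finset.univ) (f := f)
        rw [Finset.insert_eq_of_mem hmem] at h
        rw [h, G.card_edge e he, Finset.card_univ, Fintype.card_fin] at h1
        omega
      rw [← h, Finset.erase_insert hni]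
    · intro h
      rw [h, Finset.insert_erase hi]
  have h1 : G.abcTensor.apply x i = ∑ f : Fin (k - 1) → V,
      ∑ e ∈ G.edges.filter (fun e => i ∈ e),
        if insert i (Finset.univ.image f) = e then
          ((1 / ((k - 1).factorial : ℝ) * G.abcWeight e : ℝ) : ℂ) * ∏ l, x (f l) else 0 := by
    unfold HyperTensor.apply
    refine Finset.sum_congr rfl fun f _ => ?_
    rw [Finset.sum_ite_eq]
    by_cases h : insert i (Finset.univ.image f) ∈ G.edges <;> simp [abcTensor, h]
  rw [h1, Finset.sum_comm]
  refine Finset.sum_congr rfl fun e he => ?_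
  have hc : (e.erase i).card = k - 1 := by
    obtain ⟨he, hi⟩ := Finset.mem_filter.1 he
    rw [Finset.card_erase_of_mem hi, G.card_edge e he]
  have h2 : ∀ f : Fin (k - 1) → V, (if insert i (Finset.univ.image f) = e then
          ((1 / ((k - 1).factorial : ℝ) * G.abcWeight e : ℝ) : ℂ) * ∏ l, x (f l) else 0) =
      if Finset.univ.image f = e.erase i then
          ((1 / ((k - 1).factorial : ℝ) * G.abcWeight e : ℝ) : ℂ) * ∏ j ∈ e.erase i, x j
        else 0 := by
    intro f
    by_cases h : Finset.univ.image f = e.erase i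
    · rw [if_pos h, if_pos ((hins e he f).2 h), prod_eq_prod_of_image_eq hc h]
    · rw [if_neg h, if_neg (fun h' => h ((hins e he f).1 h'))]
  -- Each edge arises from `(k - 1)!` index families, which cancels the normalising factor of the
  -- tensor.
  rw [Finset.sum_congr rfl fun f _ => h2 f, ← Finset.sum_filter, Finset.sum_const,
    card_filter_image_eq _ hc, nsmul_eq_mul]
  have : ((k - 1).factorial : ℂ) ≠ 0 := by exact_mod_cast (k - 1).factorial_ne_zero
  push_cast
  field_simp

theorem one_le_degree {V : Type*} [DecidableEq V] {k : ℕ} (G : UniformHypergraph V k) {e : Finset V} (he : e ∈ G.edges) {i : V}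
    (hi : i ∈ e) : (1 : ℝ) ≤ G.degree i := by
  have : 0 < G.degree i := Finset.card_pos.2 ⟨e, Finset.mem_filter.2 ⟨he, hi⟩⟩
  exact_mod_cast this

theorem sum_degree_sub_one_nonneg {V : Type*} [DecidableEq V] {k : ℕ} (G : UniformHypergraph V k) {e : Finset V} (he : e ∈ G.edges) :
    0 ≤ ∑ i ∈ e, ((G.degree i : ℝ) - 1) :=
  Finset.sum_nonneg fun _ hi => sub_nonneg.2 (G.one_le_degree he hi)

theorem prod_degree_pos {V : Type*} [DecidableEq V] {k : ℕ} (G : UniformHypergraph V k) {e : Finset V} (he : e ∈ G.edges) :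
    0 < ∏ i ∈ e, (G.degree i : ℝ) :=
  Finset.prod_pos fun _ hi => zero_lt_one.trans_le (G.one_le_degree he hi)

theorem abcWeight_nonneg {V : Type*} [DecidableEq V] {k : ℕ} (G : UniformHypergraph V k) {e : Finset V} (he : e ∈ G.edges) :
    0 ≤ G.abcWeight e := by
  have h := G.sum_degree_sub_one_nonneg he
  rw [Finset.sum_sub_distrib, Finset.sum_const, G.card_edge e he, nsmul_eq_mul, mul_one] at h
  exact Real.rpow_nonneg (div_nonneg h (G.prod_degree_pos he).le) _

theorem abcWeight_pow {V : Type*} [DecidableEq V] {k : ℕ} (hk : k ≠ 0) (G : UniformHypergraph V k) {e : Finset V}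
    (he : e ∈ G.edges) :
    G.abcWeight e ^ k = (∑ i ∈ e, ((G.degree i : ℝ) - 1)) / ∏ i ∈ e, (G.degree i : ℝ) := by
  have h := G.sum_degree_sub_one_nonneg he
  have h' : ∑ i ∈ e, ((G.degree i : ℝ) - 1) = (∑ i ∈ e, (G.degree i : ℝ)) - k := by
    rw [Finset.sum_sub_distrib, Finset.sum_const, G.card_edge e he, nsmul_eq_mul, mul_one]
  rw [h'] at h ⊢
  rw [abcWeight, one_div, Real.rpow_inv_natCast_pow (div_nonneg h (G.prod_degree_pos he).le) hk]

end UniformHypergraph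

/-! ### Bounding eigenvalues by labellings of the incidences -/

/-- A weighted form of the inequality of arithmetic and geometric means on a set of `k`
elements. -/
theorem card_mul_prod_le {V : Type*} {k : ℕ} (hk : k ≠ 0) {s : Finset V} (hs : s.card = k)
    {w R : ℝ} {b t : V → ℝ} (hR : 0 < R) (hb : ∀ j ∈ s, 0 < b j) (ht : ∀ j ∈ s, 0 ≤ t j)
    (h : w ^ k ≤ R ^ k * ∏ j ∈ s, b j) :
    k * (w * ∏ j ∈ s, t j) ≤ R * ∑ j ∈ s, b j * t j ^ k ∧
      (k * (w * ∏ j ∈ s, t j) = R * ∑ j ∈ s, b j * t j ^ k → (∃ j ∈ s, t j ≠ 0) →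
        (∀ j ∈ s, t j ≠ 0) ∧ w ^ k = R ^ k * ∏ j ∈ s, b j) := by
  have hk0 : (0 : ℝ) < k := by exact_mod_cast Nat.pos_of_ne_zero hk
  -- AM-GM is applied to these numbers with equal weights `1 / k`; their geometric mean is `(∏
  -- b)^{1/k} ∏ t`.
  set z : V → ℝ := fun j => b j * t j ^ k with hz
  have hz0 : ∀ j ∈ s, 0 ≤ z j := fun j hj => mul_nonneg (hb j hj).le (pow_nonneg (ht j hj) _)
  have hw1 : ∑ _i ∈ s, (k : ℝ)⁻¹ = 1 := by
    rw [Finset.sum_const, hs, nsmul_eq_mul, mul_inv_cancel₀ hk0.ne']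
  have hgm := Real.geom_mean_le_arith_mean_weighted s (fun _ => (k : ℝ)⁻¹) z
    (fun _ _ => by positivity) hw1 hz0
  have hgme := Real.geom_mean_eq_arith_mean_weighted_iff_of_pos s (fun _ => (k : ℝ)⁻¹) z
    (fun _ _ => by positivity) hw1 hz0
  set P := ∏ i ∈ s, z i ^ (k : ℝ)⁻¹ with hP
  have hP0 : 0 ≤ P := Finset.prod_nonneg fun j hj => Real.rpow_nonneg (hz0 j hj) _
  have hPk : P ^ k = (∏ j ∈ s, b j) * (∏ j ∈ s, t j) ^ k := by
    rw [hP, ← Finset.prod_pow, ← Finset.prod_pow, ← Finset.prod_mul_distrib]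
    exact Finset.prod_congr rfl fun j hj => Real.rpow_inv_natCast_pow (hz0 j hj) hk
  have ht0 : 0 ≤ ∏ j ∈ s, t j := Finset.prod_nonneg ht
  have hle : w * ∏ j ∈ s, t j ≤ R * P := by
    refine le_of_pow_le_pow_left₀ hk (by positivity) ?_
    rw [mul_pow, mul_pow, hPk, ← mul_assoc]
    exact mul_le_mul_of_nonneg_right h (by positivity)
  have hsum : ∑ i ∈ s, (k : ℝ)⁻¹ * z i = (k : ℝ)⁻¹ * ∑ i ∈ s, z i := by rw [Finset.mul_sum]
  rw [hsum] at hgm hgme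
  have hgm' : k * P ≤ ∑ i ∈ s, z i := by
    calc k * P ≤ k * ((k : ℝ)⁻¹ * ∑ i ∈ s, z i) := by gcongr
      _ = _ := by field_simp
  constructor
  · calc (k : ℝ) * (w * ∏ j ∈ s, t j) ≤ k * (R * P) := by gcongr
      _ = R * (k * P) := by ring
      _ ≤ _ := by gcongr
  · rintro heq ⟨j, hj, hj0⟩
    have h1 : R * (k * P) ≤ R * ∑ i ∈ s, z i := by gcongr
    have h2 : k * (w * ∏ j ∈ s, t j) ≤ k * (R * P) := by gcongr
    have h3 : R * (k * P) = R * ∑ i ∈ s, z i := by linarith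
    have h4 : (k : ℝ) * P = ∑ i ∈ s, z i := mul_left_cancel₀ hR.ne' h3
    have h5 : w * ∏ j ∈ s, t j = R * P := by
      refine mul_left_cancel₀ hk0.ne' ?_
      linarith
    -- Equality in AM-GM makes all `z j` equal, so one nonzero `t j` makes all of them nonzero.
    have h6 := hgme.1 (by rw [← h4]; field_simp)
    have h7 : ∀ i ∈ s, t i ≠ 0 := by
      intro i hi hi0
      have := h6 i hi j hj
      simp only [hz, hi0, zero_pow hk, mul_zero] at this
      have hjp : 0 < b j * t j ^ k :=
        mul_pos (hb j hj) (pow_pos (lt_of_le_of_ne (ht j hj) (Ne.symm hj0)) _)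
      linarith
    refine ⟨h7, ?_⟩
    have hprod : (∏ j ∈ s, t j) ^ k ≠ 0 := pow_ne_zero _ (Finset.prod_ne_zero_iff.2 h7)
    refine mul_right_cancel₀ hprod ?_
    rw [← mul_pow, h5, mul_pow, hPk, mul_assoc]

namespace UniformHypergraph

/-- A set of vertices that is closed under the edges of a connected hypergraph is everything. -/
theorem Connected.mem_of_closed {V : Type*} {k : ℕ} {G : UniformHypergraph V k}
    (hG : G.Connected) {S : Set V} (hS : S.Nonempty)
    (hcl : ∀ e ∈ G.edges, (∃ x ∈ e, x ∈ S) → ∀ y ∈ e, y ∈ S) (w : V) : w ∈ S := by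
  obtain ⟨u, hu⟩ := hS
  obtain ⟨ℓ, v, e, ⟨-, -, he, hve, -⟩, h0, h1⟩ := hG u w
  rw [← h1]
  have : ∀ i : Fin (ℓ + 1), v i ∈ S := by
    intro i
    induction i using Fin.induction with
    | zero => exact h0 ▸ hu
    | succ i ih => exact hcl (e i) (he i) ⟨_, (hve i).1, ih⟩ _ (hve i).2
  exact this _

theorem sum_edges_sum {V : Type*} [Fintype V] [DecidableEq V] {k : ℕ}
    (G : UniformHypergraph V k) (F : V → Finset V → ℝ) :
    ∑ e ∈ G.edges, ∑ j ∈ e, F j e = ∑ j, ∑ e ∈ G.edges.filter (fun e => j ∈ e), F j e := by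
  rw [Finset.sum_comm' (t' := Finset.univ) (s' := fun j => G.edges.filter (fun e => j ∈ e))]
  simp

/-- Multiplying the equation at `i` by `x i` completes each product to the whole edge. After
summation over `i` every edge is counted once for each of its `k` vertices. -/
theorem norm_eigenvalue_mul_sum_le {V : Type*} [Fintype V] [DecidableEq V] {k : ℕ} (hk : 2 ≤ k)
    (G : UniformHypergraph V k) {μ : ℂ} {x : V → ℂ}
    (hx : ∀ i, G.abcTensor.apply x i = μ * x i ^ (k - 1)) :
    ‖μ‖ * ∑ i, ‖x i‖ ^ k ≤ ∑ e ∈ G.edges, k * (G.abcWeight e * ∏ j ∈ e, ‖x j‖) := by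
  have h1 : ∀ i, ‖μ‖ * ‖x i‖ ^ k ≤
      ∑ e ∈ G.edges.filter (fun e => i ∈ e), G.abcWeight e * ∏ j ∈ e, ‖x j‖ := by
    intro i
    have h2 : ‖μ‖ * ‖x i‖ ^ k = ‖G.abcTensor.apply x i‖ * ‖x i‖ := by
      rw [hx, norm_mul, norm_pow, mul_assoc, ← pow_succ, Nat.sub_add_cancel (by omega)]
    rw [h2, abcTensor_apply hk]
    refine (mul_le_mul_of_nonneg_right (norm_sum_le _ _) (norm_nonneg _)).trans ?_
    rw [Finset.sum_mul]
    refine Finset.sum_le_sum fun e he => ?_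
    obtain ⟨he, hi⟩ := Finset.mem_filter.1 he
    rw [norm_mul, norm_prod, Complex.norm_real, Real.norm_eq_abs,
      abs_of_nonneg (G.abcWeight_nonneg he), mul_assoc, mul_comm (∏ j ∈ e.erase i, ‖x j‖),
      Finset.mul_prod_erase e (fun j => ‖x j‖) hi]
  rw [Finset.mul_sum]
  refine (Finset.sum_le_sum fun i _ => h1 i).trans (le_of_eq ?_)
  rw [← G.sum_edges_sum (fun _ e => G.abcWeight e * ∏ j ∈ e, ‖x j‖)]
  refine Finset.sum_congr rfl fun e he => ?_
  rw [Finset.sum_const, G.card_edge e he, nsmul_eq_mul]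

/-- An upper bound for the eigenvalues of the ABC tensor from a positive labelling of the
incidences, and a consequence of equality. -/
theorem norm_eigenvalue_le_of_labelling {V : Type*} [Fintype V] [DecidableEq V] {k : ℕ}
    (hk : 2 ≤ k) (G : UniformHypergraph V k) {r : ℝ} (hr : 0 < r) (C : V → Finset V → ℝ)
    (hpos : ∀ e ∈ G.edges, ∀ i ∈ e, 0 < C i e)
    (hsum : ∀ i, ∑ e ∈ G.edges.filter (fun e => i ∈ e), C i e ≤ G.degree i)
    (hprod : ∀ e ∈ G.edges, ∑ i ∈ e, ((G.degree i : ℝ) - 1) ≤ r * ∏ i ∈ e, C i e)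
    {μ : ℂ} (hμ : G.abcTensor.IsEigenvalue μ) :
    ‖μ‖ ≤ r ^ (1 / (k : ℝ)) ∧ (G.Connected → ‖μ‖ = r ^ (1 / (k : ℝ)) →
      ∀ e ∈ G.edges, ∑ i ∈ e, ((G.degree i : ℝ) - 1) = r * ∏ i ∈ e, C i e) := by
  obtain ⟨x, hx0, hx⟩ := hμ
  have hk0 : k ≠ 0 := by omega
  set R : ℝ := r ^ (1 / (k : ℝ)) with hRdef
  have hR : 0 < R := Real.rpow_pos_of_pos hr _
  have hRk : R ^ k = r := by rw [hRdef, one_div, Real.rpow_inv_natCast_pow hr.le hk0]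
  -- These weights add up to at most `1` at each vertex, and the division by degrees absorbs the
  -- denominator of the ABC weight.
  set b : V → Finset V → ℝ := fun j e => C j e / G.degree j with hb
  have hd : ∀ e ∈ G.edges, ∀ j ∈ e, (0 : ℝ) < G.degree j := fun e he j hj =>
    zero_lt_one.trans_le (G.one_le_degree he hj)
  have hb0 : ∀ e ∈ G.edges, ∀ j ∈ e, 0 < b j e := fun e he j hj =>
    div_pos (hpos e he j hj) (hd e he j hj)
  have hbprod : ∀ e, r * ∏ j ∈ e, b j e =
      (r * ∏ j ∈ e, C j e) / ∏ j ∈ e, (G.degree j : ℝ) := by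
    intro e
    rw [hb, Finset.prod_div_distrib, mul_div_assoc]
  have key := fun e (he : e ∈ G.edges) =>
    card_mul_prod_le hk0 (G.card_edge e he) (w := G.abcWeight e) (R := R)
      (b := fun j => b j e) (t := fun j => ‖x j‖) hR (hb0 e he) (fun _ _ => norm_nonneg _)
      (by
        rw [hRk, hbprod, G.abcWeight_pow hk0 he]
        exact div_le_div_of_nonneg_right (hprod e he) (G.prod_degree_pos he).le)
  have hX : 0 < ∑ i, ‖x i‖ ^ k := by
    obtain ⟨i, hi⟩ := Function.ne_iff.1 hx0
    exact Finset.sum_pos' (fun _ _ => by positivity)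
      ⟨i, Finset.mem_univ _, pow_pos (norm_pos_iff.2 hi) _⟩
  have h1 := G.norm_eigenvalue_mul_sum_le hk hx
  have h2 : ∑ e ∈ G.edges, R * ∑ j ∈ e, b j e * ‖x j‖ ^ k ≤ R * ∑ i, ‖x i‖ ^ k := by
    rw [← Finset.mul_sum, G.sum_edges_sum (fun j e => b j e * ‖x j‖ ^ k)]
    refine mul_le_mul_of_nonneg_left (Finset.sum_le_sum fun j _ => ?_) hR.le
    rw [← Finset.sum_mul]
    refine mul_le_of_le_one_left (by positivity) ?_
    rw [hb]
    simp only
    rw [← Finset.sum_div]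
    exact div_le_one_of_le₀ (hsum j) (by positivity)
  have h3 : ∑ e ∈ G.edges, k * (G.abcWeight e * ∏ j ∈ e, ‖x j‖) ≤
      ∑ e ∈ G.edges, R * ∑ j ∈ e, b j e * ‖x j‖ ^ k :=
    Finset.sum_le_sum fun e he => (key e he).1
  refine ⟨le_of_mul_le_mul_right (h1.trans (h3.trans h2)) hX, fun hconn heq => ?_⟩
  rw [heq] at h1
  have h4 := (Finset.sum_eq_sum_iff_of_le fun e he => (key e he).1).1
    (le_antisymm h3 (h2.trans h1))
  -- The support of `x` is closed under edges by the equality case of AM-GM, hence it is everything.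
  have hne : ∀ w, x w ≠ 0 := by
    refine fun w => hconn.mem_of_closed (S := {w | x w ≠ 0}) (Function.ne_iff.1 hx0) ?_ w
    rintro e he ⟨y, hy, hy0⟩ z hz
    exact norm_ne_zero_iff.1
      (((key e he).2 (h4 e he) ⟨y, hy, norm_ne_zero_iff.2 hy0⟩).1 z hz)
  intro e he
  obtain ⟨y, hy⟩ : e.Nonempty := by
    rw [← Finset.card_pos, G.card_edge e he]
    omega
  have h5 := ((key e he).2 (h4 e he) ⟨y, hy, norm_ne_zero_iff.2 (hne y)⟩).2
  rw [hRk, hbprod, G.abcWeight_pow hk0 he] at h5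
  exact (div_left_inj' (G.prod_degree_pos he).ne').1 h5

theorem exists_norm_eq_abcSpectralRadius {V : Type*} [Fintype V] [DecidableEq V] [Nonempty V]
    {k : ℕ} (hk : 2 ≤ k) (G : UniformHypergraph V k) :
    ∃ μ : ℂ, G.abcTensor.IsEigenvalue μ ∧ ‖μ‖ = G.abcSpectralRadius :=
  (HyperTensor.isGreatest_spectralRadius _ (exists_isEigenvalue_abcTensor hk G)).1

theorem norm_le_abcSpectralRadius {V : Type*} [Fintype V] [DecidableEq V] {k : ℕ}
    (G : UniformHypergraph V k) {μ : ℂ} (hμ : G.abcTensor.IsEigenvalue μ) :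
    ‖μ‖ ≤ G.abcSpectralRadius :=
  (HyperTensor.isGreatest_spectralRadius _ ⟨μ, hμ⟩).2 ⟨μ, hμ, rfl⟩

theorem abcSpectralRadius_le_of_labelling {V : Type*} [Fintype V] [DecidableEq V] [Nonempty V]
    {k : ℕ} (hk : 2 ≤ k) {G : UniformHypergraph V k} (hG : G.Connected) {r : ℝ} (hr : 0 < r)
    (C : V → Finset V → ℝ) (hpos : ∀ e ∈ G.edges, ∀ i ∈ e, 0 < C i e)
    (hsum : ∀ i, ∑ e ∈ G.edges.filter (fun e => i ∈ e), C i e ≤ G.degree i)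
    (hprod : ∀ e ∈ G.edges, ∑ i ∈ e, ((G.degree i : ℝ) - 1) ≤ r * ∏ i ∈ e, C i e) :
    G.abcSpectralRadius ≤ r ^ (1 / (k : ℝ)) ∧ (G.abcSpectralRadius = r ^ (1 / (k : ℝ)) →
      ∀ e ∈ G.edges, ∑ i ∈ e, ((G.degree i : ℝ) - 1) = r * ∏ i ∈ e, C i e) := by
  obtain ⟨μ, hμ, h⟩ := G.exists_norm_eq_abcSpectralRadius hk
  obtain ⟨h1, h2⟩ := norm_eigenvalue_le_of_labelling hk G hr C hpos hsum hprod hμ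
  rw [← h]
  exact ⟨h1, h2 hG⟩

/-- An eigenvalue of the ABC tensor from a consistent labelling of the incidences. -/
theorem le_abcSpectralRadius_of_labelling {V : Type*} [Fintype V] [DecidableEq V] [Nonempty V]
    {k : ℕ} (hk : 2 ≤ k) (G : UniformHypergraph V k) {r : ℝ} (hr : 0 ≤ r)
    (C : V → Finset V → ℝ) (hpos : ∀ e ∈ G.edges, ∀ i ∈ e, 0 < C i e) (hdeg : ∀ i, 0 < G.degree i)
    (hsum : ∀ i, ∑ e ∈ G.edges.filter (fun e => i ∈ e), C i e = G.degree i)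
    (hprod : ∀ e ∈ G.edges, ∑ i ∈ e, ((G.degree i : ℝ) - 1) = r * ∏ i ∈ e, C i e)
    (y : V → ℝ) (hy : ∀ i, 0 < y i) (c : Finset V → ℝ)
    (hc : ∀ e ∈ G.edges, ∀ i ∈ e, C i e * y i = c e) :
    r ^ (1 / (k : ℝ)) ≤ G.abcSpectralRadius := by
  have hk0 : k ≠ 0 := by omega
  set R : ℝ := r ^ (1 / (k : ℝ)) with hRdef
  have hR : 0 ≤ R := Real.rpow_nonneg hr _
  have hRk : R ^ k = r := by rw [hRdef, one_div, Real.rpow_inv_natCast_pow hr hk0]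
  have hd : ∀ j, (0 : ℝ) < G.degree j := fun j => by exact_mod_cast hdeg j
  set x : V → ℝ := fun i => (G.degree i * y i) ^ (1 / (k : ℝ)) with hxdef
  have hx : ∀ i, 0 < x i := fun i => Real.rpow_pos_of_pos (mul_pos (hd i) (hy i)) _
  have hxk : ∀ i, x i ^ k = G.degree i * y i := fun i => by
    rw [hxdef]
    simp only
    rw [one_div, Real.rpow_inv_natCast_pow (mul_pos (hd i) (hy i)).le hk0]
  have hc0 : ∀ e ∈ G.edges, 0 ≤ c e := by
    intro e he
    obtain ⟨j, hj⟩ : e.Nonempty := by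
      rw [← Finset.card_pos, G.card_edge e he]
      omega
    exact hc e he j hj ▸ (mul_pos (hpos e he j hj) (hy j)).le
  have hedge : ∀ e ∈ G.edges, G.abcWeight e * ∏ j ∈ e, x j = R * c e := by
    intro e he
    have h1 : 0 ≤ ∏ j ∈ e, x j := Finset.prod_nonneg fun j _ => (hx j).le
    refine (pow_left_inj₀ (mul_nonneg (G.abcWeight_nonneg he) h1)
      (mul_nonneg hR (hc0 e he)) hk0).1 ?_
    rw [mul_pow, mul_pow, hRk, G.abcWeight_pow hk0 he, hprod e he, ← Finset.prod_pow,
      Finset.prod_congr rfl fun j _ => hxk j, Finset.prod_mul_distrib]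
    -- Here consistency enters: all `k` factors `C i e * y i` equal `c e`.
    have h2 : (∏ i ∈ e, C i e) * ∏ i ∈ e, y i = c e ^ k := by
      rw [← Finset.prod_mul_distrib, Finset.prod_congr rfl (hc e he), Finset.prod_const,
        G.card_edge e he]
    have h3 := (G.prod_degree_pos he).ne'
    rw [← h2]
    field_simp
  have hev : G.abcTensor.IsEigenvalue (R : ℂ) := by
    refine ⟨fun i => (x i : ℂ), ?_, fun i => ?_⟩
    · obtain ⟨i⟩ := ‹Nonempty V›
      exact fun h => (hx i).ne' (by simpa using congrFun h i)
    · rw [abcTensor_apply hk]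
      have h1 : (∑ e ∈ G.edges.filter (fun e => i ∈ e),
          G.abcWeight e * ∏ j ∈ e.erase i, x j) = R * x i ^ (k - 1) := by
        refine mul_right_cancel₀ (hx i).ne' ?_
        rw [mul_assoc, ← pow_succ, Nat.sub_add_cancel (by omega), hxk, ← hsum, Finset.sum_mul,
          Finset.sum_mul, Finset.mul_sum]
        refine Finset.sum_congr rfl fun e he => ?_
        obtain ⟨he, hi⟩ := Finset.mem_filter.1 he
        rw [hc e he i hi, ← hedge e he, mul_assoc, Finset.prod_erase_mul e x hi]
      simpa using congrArg (fun t : ℝ => (t : ℂ)) h1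
  have := G.norm_le_abcSpectralRadius hev
  rwa [Complex.norm_real, Real.norm_eq_abs, abs_of_nonneg hR] at this

end UniformHypergraph

/-! ### Connectedness and short cycles in hypertrees -/

namespace UniformHypergraph

/-- Connectedness transferred to edges: the vertices covered by edges with property `P` form a
closed set. -/
theorem Connected.edge_of_closed {V : Type*} [DecidableEq V] {k : ℕ} (hk : 2 ≤ k)
    {G : UniformHypergraph V k} (hG : G.Connected) {P : Finset V → Prop} {e₀ : Finset V}
    (he₀ : e₀ ∈ G.edges) (h₀ : P e₀)
    (hP : ∀ e ∈ G.edges, ∀ f ∈ G.edges, P e → ∀ x, x ∈ e → x ∈ f → P f) :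
    ∀ f ∈ G.edges, P f := by
  intro f hf
  have hne : ∀ e ∈ G.edges, e.Nonempty := fun e he => by
    rw [← Finset.card_pos, G.card_edge e he]
    omega
  obtain ⟨w, hw⟩ := hne f hf
  obtain ⟨u, hu⟩ := hne e₀ he₀
  obtain ⟨e, he, hPe, hwe⟩ := hG.mem_of_closed (S := {x | ∃ e ∈ G.edges, P e ∧ x ∈ e})
    ⟨u, e₀, he₀, h₀, hu⟩ (by
      rintro e he ⟨x, hx, g, hg, hPg, hxg⟩ y hy
      exact ⟨e, he, hP g hg e he hPg x hxg hx, hy⟩) w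
  exact hP e he f hf hPe w hwe hw

theorem Connected.exists_edge {V : Type*} [DecidableEq V] {k : ℕ} (hk : 2 ≤ k)
    {G : UniformHypergraph V k} (hG : G.Connected) (hE : G.edges.Nonempty) (i : V) :
    ∃ e ∈ G.edges, i ∈ e := by
  obtain ⟨e, he⟩ := hE
  obtain ⟨u, hu⟩ : e.Nonempty := by
    rw [← Finset.card_pos, G.card_edge e he]
    omega
  exact hG.mem_of_closed (S := {x | ∃ e ∈ G.edges, x ∈ e}) ⟨u, e, he, hu⟩
    (fun f hf _ y hy => ⟨f, hf, hy⟩) i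

/-- Two distinct edges of a hypertree share at most one vertex. -/
theorem IsHypertree.linear {V : Type*} {k : ℕ} {G : UniformHypergraph V k} (hG : G.IsHypertree)
    {e f : Finset V} (he : e ∈ G.edges) (hf : f ∈ G.edges) (hef : e ≠ f) {x y : V}
    (hxe : x ∈ e) (hxf : x ∈ f) (hye : y ∈ e) (hyf : y ∈ f) : x = y := by
  by_contra hxy
  -- This is a cycle of length 2, for which the disjointness condition is vacuous.
  refine hG.2 0 ![x, y] ![e, f] ⟨?_, ?_, ?_, ?_, ?_⟩
  · intro a b h
    fin_cases a <;> fin_cases b <;> simp_all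
  · intro a b h
    fin_cases a <;> fin_cases b <;> simp_all
  · intro a
    fin_cases a <;> simp_all
  · intro a
    fin_cases a <;> simp_all
  · intro a b h
    fin_cases a <;> fin_cases b <;> simp_all

/-- Otherwise linearity makes the three vertices distinct, which gives a cycle of length 3. All its
edges are consecutive, so no disjointness is required. Hence three pairwise meeting edges have a
common vertex. -/
theorem IsHypertree.triangle {V : Type*} {k : ℕ} {G : UniformHypergraph V k}
    (hG : G.IsHypertree) {e f g : Finset V} (he : e ∈ G.edges) (hf : f ∈ G.edges)
    (hg : g ∈ G.edges) (hef : e ≠ f) (hfg : f ≠ g) (hge : g ≠ e) {x y z : V}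
    (hxe : x ∈ e) (hxf : x ∈ f) (hyf : y ∈ f) (hyg : y ∈ g) (hzg : z ∈ g) (hze : z ∈ e) :
    x = y := by
  by_contra hxy
  have hyz : y ≠ z := by
    rintro rfl
    exact hxy (hG.linear he hf hef hxe hxf hze hyf)
  have hzx : z ≠ x := by
    rintro rfl
    exact hxy (hG.linear hf hg hfg hxf hzg hyf hyg)
  refine hG.2 1 ![z, x, y] ![e, f, g] ⟨?_, ?_, ?_, ?_, ?_⟩
  · intro a b h
    fin_cases a <;> fin_cases b <;> simp_all
  · intro a b h
    fin_cases a <;> fin_cases b <;> simp_all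
  · intro a
    fin_cases a <;> simp_all
  · intro a
    fin_cases a
    · exact ⟨hze, hxe⟩
    · exact ⟨hxf, hyf⟩
    · exact ⟨hyg, hzg⟩
  · intro a b h1 h2 h3
    fin_cases a <;> fin_cases b <;> (exfalso; revert h1 h2 h3; decide)

theorem IsHypertree.square {V : Type*} {k : ℕ} {G : UniformHypergraph V k}
    (hG : G.IsHypertree) {e f g h : Finset V} (he : e ∈ G.edges) (hf : f ∈ G.edges)
    (hg : g ∈ G.edges) (hh : h ∈ G.edges) (heg : Disjoint e g) (hfh : Disjoint f h)
    {x y z w : V} (hxe : x ∈ e) (hxf : x ∈ f) (hyf : y ∈ f) (hyg : y ∈ g) (hzg : z ∈ g)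
    (hzh : z ∈ h) (hwh : w ∈ h) (hwe : w ∈ e) : False := by
  have d1 := Finset.disjoint_left.1 heg
  have d2 := Finset.disjoint_left.1 hfh
  have n1 : x ≠ y := fun H => d1 hxe (H ▸ hyg)
  have n2 : x ≠ z := fun H => d1 hxe (H ▸ hzg)
  have n3 : x ≠ w := fun H => d2 hxf (H ▸ hwh)
  have n4 : y ≠ z := fun H => d2 hyf (H ▸ hzh)
  have n5 : y ≠ w := fun H => d2 hyf (H ▸ hwh)
  have n6 : w ≠ z := fun H => d1 hwe (H ▸ hzg)
  have m1 : e ≠ f := fun H => d1 (H ▸ hyf) hyg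
  have m2 : e ≠ g := fun H => d1 hxe (H ▸ hxe)
  have m3 : e ≠ h := fun H => d1 (H ▸ hzh) hzg
  have m4 : f ≠ g := fun H => d1 hxe (H ▸ hxf)
  have m5 : f ≠ h := fun H => d2 hxf (H ▸ hxf)
  have m6 : g ≠ h := fun H => d1 hwe (H ▸ hwh)
  refine hG.2 2 ![w, x, y, z] ![e, f, g, h] ⟨?_, ?_, ?_, ?_, ?_⟩
  · intro a b H
    fin_cases a <;> fin_cases b <;> first | rfl | (exfalso; simp at H; tauto)
  · intro a b H
    fin_cases a <;> fin_cases b <;> first | rfl | (exfalso; simp at H; tauto)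
  · intro a
    fin_cases a <;> simpa
  · intro a
    fin_cases a
    · exact ⟨hwe, hxe⟩
    · exact ⟨hxf, hyf⟩
    · exact ⟨hyg, hzg⟩
    · exact ⟨hzh, hwh⟩
  · intro a b h1 h2 h3
    fin_cases a <;> fin_cases b <;>
      first
      | exact heg
      | exact heg.symm
      | exact hfh
      | exact hfh.symm
      | (exfalso; revert h1 h2 h3; decide)

/-- At most one edge of a hypertree meets two given disjoint edges. -/
theorem IsHypertree.eq_of_meet_disjoint {V : Type*} {k : ℕ} {G : UniformHypergraph V k}
    (hG : G.IsHypertree) {e g f h : Finset V} (he : e ∈ G.edges) (hf : f ∈ G.edges)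
    (hg : g ∈ G.edges) (hh : h ∈ G.edges) (heg : Disjoint e g)
    {x y z w : V} (hxe : x ∈ e) (hxf : x ∈ f) (hyf : y ∈ f) (hyg : y ∈ g) (hzg : z ∈ g)
    (hzh : z ∈ h) (hwh : w ∈ h) (hwe : w ∈ e) : f = h := by
  by_contra hfh
  have d1 := Finset.disjoint_left.1 heg
  by_cases hd : Disjoint f h
  · exact hG.square he hf hg hh heg hd hxe hxf hyf hyg hzg hzh hwh hwe
  · obtain ⟨t, htf, hth⟩ := Finset.not_disjoint_iff.1 hd
    have m1 : e ≠ f := fun H => d1 (H ▸ hyf) hyg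
    have m3 : e ≠ h := fun H => d1 (H ▸ hzh) hzg
    have m4 : f ≠ g := fun H => d1 hxe (H ▸ hxf)
    have m6 : g ≠ h := fun H => d1 hwe (H ▸ hwh)
    -- The triangles `e, f, h` and `g, f, h` both collapse to the common vertex `t` of `f` and `h`,
    -- which would then lie in `e` and in `g`.
    have h1 := hG.triangle he hf hh m1 hfh m3.symm hxe hxf htf hth hwh hwe
    have h2 := hG.triangle hg hf hh m4.symm hfh m6.symm hyg hyf htf hth hzh hzg
    exact d1 hxe (h1.trans h2.symm ▸ hyg)

/-- The edges that meet a given edge, other than that edge. -/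
def meeting {V : Type*} [DecidableEq V] {k : ℕ} (G : UniformHypergraph V k) (e : Finset V) :
    Finset (Finset V) :=
  (G.edges.erase e).filter (fun f => ¬ Disjoint e f)

theorem mem_meeting {V : Type*} [DecidableEq V] {k : ℕ} {G : UniformHypergraph V k}
    {e f : Finset V} :
    f ∈ G.meeting e ↔ f ≠ e ∧ f ∈ G.edges ∧ ∃ x ∈ e, x ∈ f := by
  rw [meeting, Finset.mem_filter, Finset.mem_erase, Finset.not_disjoint_iff, and_assoc]

theorem degree_sub_one {V : Type*} [DecidableEq V] {k : ℕ} (G : UniformHypergraph V k)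
    {e : Finset V} (he : e ∈ G.edges) {i : V} (hi : i ∈ e) :
    (G.degree i : ℝ) - 1 = ((G.edges.erase e).filter (fun f => i ∈ f)).card := by
  have : G.degree i = ((G.edges.erase e).filter (fun f => i ∈ f)).card + 1 := by
    rw [degree, Finset.filter_erase, Finset.card_erase_add_one]
    exact Finset.mem_filter.2 ⟨he, hi⟩
  rw [this]
  push_cast
  ring

/-- By linearity an edge meeting `e` is counted at exactly one vertex of `e`. This turns the
numerator of the ABC weight into a count of neighbouring edges. -/
theorem IsHypertree.sum_degree_sub_one {V : Type*} [DecidableEq V] {k : ℕ}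
    {G : UniformHypergraph V k} (hG : G.IsHypertree) {e : Finset V} (he : e ∈ G.edges) :
    ∑ i ∈ e, ((G.degree i : ℝ) - 1) = (G.meeting e).card := by
  have h1 : G.meeting e = e.biUnion (fun i => (G.edges.erase e).filter (fun f => i ∈ f)) := by
    ext f
    simp only [mem_meeting, Finset.mem_biUnion, Finset.mem_filter, Finset.mem_erase]
    tauto
  rw [h1, Finset.card_biUnion, Nat.cast_sum]
  · exact Finset.sum_congr rfl fun i hi => G.degree_sub_one he hi
  · intro i hi j hj hij
    rw [Function.onFun, Finset.disjoint_left]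
    intro f hf hf'
    simp only [Finset.mem_filter, Finset.mem_erase] at hf hf'
    exact hij (hG.linear he hf.1.2 hf.1.1.symm hi hf.2 hj hf'.2)

end UniformHypergraph

/-! ### Pendant factors and the extremal product -/

/-- The factor that a vertex of degree `1 + a`, all of whose other edges are pendant, contributes
to an edge. -/
noncomputable def pendantFactor (r a : ℝ) : ℝ := 1 + a - a ^ 2 / r

theorem pendantFactor_zero (r : ℝ) : pendantFactor r 0 = 1 := by simp [pendantFactor]

/-- The source of submultiplicativity: the right side is nonnegative for `a, b ≥ 0` and `a + b ≤ r +
2`, so merging two attaching vertices lowers the product. -/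
theorem pendantFactor_mul_sub {r : ℝ} (hr : 0 < r) (a b : ℝ) :
    pendantFactor r a * pendantFactor r b - pendantFactor r (a + b) =
      a * b * ((r * (r + 2 - (a + b)) + a * b) / r ^ 2) := by
  unfold pendantFactor
  field_simp
  ring

theorem pendantFactor_add_le {r a b : ℝ} (hr : 0 < r) (ha : 0 ≤ a) (hb : 0 ≤ b)
    (hab : a + b ≤ r + 2) : pendantFactor r (a + b) ≤ pendantFactor r a * pendantFactor r b := by
  rw [← sub_nonneg, pendantFactor_mul_sub hr]
  have : 0 ≤ r + 2 - (a + b) := by linarith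
  positivity

theorem pendantFactor_add_lt {r a b : ℝ} (hr : 0 < r) (ha : 0 < a) (hb : 0 < b)
    (hab : a + b ≤ r + 2) : pendantFactor r (a + b) < pendantFactor r a * pendantFactor r b := by
  rw [← sub_pos, pendantFactor_mul_sub hr]
  have : 0 ≤ r + 2 - (a + b) := by linarith
  positivity

/-- For a fixed sum and both arguments at least `1`, the product is least at the most unbalanced
pair; the factor `(a - 1) * (b - 1)` also gives the equality case. -/
theorem pendantFactor_mul_sub_mul {r : ℝ} (hr : 0 < r) (a b : ℝ) :
    pendantFactor r a * pendantFactor r b - pendantFactor r 1 * pendantFactor r (a + b - 1) =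
      (a - 1) * (b - 1) *
        ((r * (r + 2 - (a + b)) + (a * b + (a + b - 1))) / r ^ 2) := by
  unfold pendantFactor
  field_simp
  ring

theorem pendantFactor_one_mul_le {r a b : ℝ} (hr : 0 < r) (ha : 1 ≤ a) (hb : 1 ≤ b)
    (hab : a + b ≤ r + 2) :
    pendantFactor r 1 * pendantFactor r (a + b - 1) ≤ pendantFactor r a * pendantFactor r b ∧
      (pendantFactor r 1 * pendantFactor r (a + b - 1) = pendantFactor r a * pendantFactor r b →
        a = 1 ∨ b = 1) := by
  have h := pendantFactor_mul_sub_mul hr a b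
  have h1 : 0 ≤ r + 2 - (a + b) := by linarith
  have h2 : 0 ≤ a - 1 := by linarith
  have h3 : 0 ≤ b - 1 := by linarith
  have h4 : 0 < a * b + (a + b - 1) := by nlinarith
  have h5 : 0 < (r * (r + 2 - (a + b)) + (a * b + (a + b - 1))) / r ^ 2 := by positivity
  constructor
  · rw [← sub_nonneg, h]
    positivity
  · intro heq
    rw [heq, sub_self] at h
    rcases mul_eq_zero.1 h.symm with h6 | h6
    · rcases mul_eq_zero.1 h6 with h6 | h6
      · exact Or.inl (by linarith)
      · exact Or.inr (by linarith)
    · exact absurd h6 h5.ne'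

theorem pendantFactor_sum_le_prod {ι : Type*} {r : ℝ} (hr : 0 < r) (s : Finset ι) (a : ι → ℝ)
    (ha : ∀ i ∈ s, 0 ≤ a i) (hp : ∀ i ∈ s, 0 ≤ pendantFactor r (a i))
    (hs : ∑ i ∈ s, a i ≤ r + 2) :
    pendantFactor r (∑ i ∈ s, a i) ≤ ∏ i ∈ s, pendantFactor r (a i) := by
  classical
  induction s using Finset.induction_on with
  | empty => simp [pendantFactor_zero]
  | insert i s hi ih =>
    rw [Finset.sum_insert hi] at hs ⊢
    rw [Finset.prod_insert hi]
    have h0 : 0 ≤ a i := ha i (Finset.mem_insert_self _ _)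
    have ha' : ∀ j ∈ s, 0 ≤ a j := fun j hj => ha j (Finset.mem_insert_of_mem hj)
    refine (pendantFactor_add_le hr h0 (Finset.sum_nonneg ha') hs).trans ?_
    exact mul_le_mul_of_nonneg_left
      (ih ha' (fun j hj => hp j (Finset.mem_insert_of_mem hj)) (by linarith))
      (hp i (Finset.mem_insert_self _ _))

theorem sum_eq_zero_or_one_le {ι : Type*} (s : Finset ι) (a : ι → ℝ)
    (ha : ∀ i ∈ s, a i = 0 ∨ 1 ≤ a i) :
    (∀ i ∈ s, a i = 0) ∨ ∃ i ∈ s, 1 ≤ a i ∧ a i ≤ ∑ j ∈ s, a j := by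
  by_cases h : ∀ i ∈ s, a i = 0
  · exact Or.inl h
  · push Not at h
    obtain ⟨i, hi, hi0⟩ := h
    refine Or.inr ⟨i, hi, (ha i hi).resolve_left hi0, ?_⟩
    exact Finset.single_le_sum
      (fun j hj => (ha j hj).elim (fun h => h.ge) zero_le_one.trans) hi

/-- The `k`-th power of the second largest ABC spectral radius. -/
noncomputable def secondRadius (M : ℝ) : ℝ :=
  (M ^ 2 - 3 * M + 3 + √((M - 1) ^ 2 + (M - 2) ^ 4)) / (2 * (M - 1))

/-- This is the quadratic equation of which `secondRadius M` is the larger root. It is the equality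
condition at the central edge of the double star, with denominators cleared. -/
theorem secondRadius_root {M : ℝ} (hM : 3 ≤ M) :
    (2 * secondRadius M - 1) * ((M - 1) * secondRadius M - (M - 2) ^ 2) =
      (M - 1) * secondRadius M := by
  have h1 : M - 1 ≠ 0 := by linarith
  have h2 : √((M - 1) ^ 2 + (M - 2) ^ 4) ^ 2 = (M - 1) ^ 2 + (M - 2) ^ 4 :=
    Real.sq_sqrt (by positivity)
  unfold secondRadius
  set q := √((M - 1) ^ 2 + (M - 2) ^ 4)
  field_simp
  linear_combination h2

/-- Replacing the square root by the smaller `(M - 2)^2` gives `M - 5/2 + 1/(M - 1)`. This is the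
main numerical estimate for the radius. -/
theorem lt_secondRadius {M : ℝ} (hM : 3 ≤ M) : M - 5 / 2 < secondRadius M := by
  have h1 : 0 < M - 1 := by linarith
  have h2 : (M - 2) ^ 2 ≤ √((M - 1) ^ 2 + (M - 2) ^ 4) :=
    Real.le_sqrt_of_sq_le (by nlinarith [sq_nonneg (M - 1)])
  unfold secondRadius
  rw [lt_div_iff₀ (by positivity)]
  nlinarith

/-- At `M = 4` the general bound `3/2` is too weak for an edge that misses one other edge. -/
theorem secondRadius_four : secondRadius 4 = 2 := by
  have : √(((4 : ℝ) - 1) ^ 2 + (4 - 2) ^ 4) = 5 := by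
    rw [show ((4 : ℝ) - 1) ^ 2 + (4 - 2) ^ 4 = 5 ^ 2 by norm_num, Real.sqrt_sq (by norm_num)]
  unfold secondRadius
  rw [this]
  norm_num

theorem pendantFactor_secondRadius {M : ℝ} (hM : 3 ≤ M) :
    pendantFactor (secondRadius M) 1 * pendantFactor (secondRadius M) (M - 2) =
      (M - 1) / secondRadius M := by
  have h1 := secondRadius_root hM
  have h2 := lt_secondRadius hM
  have h3 : 0 < secondRadius M := by linarith
  unfold pendantFactor
  field_simp
  linear_combination h1

/-- The root equation gives positivity at `a = M - 2`, and `a² / (1 + a)` is increasing. -/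
theorem pendantFactor_pos {M a : ℝ} (hM : 3 ≤ M) (ha : 0 ≤ a) (haM : a ≤ M - 2) :
    0 < pendantFactor (secondRadius M) a := by
  have h1 := secondRadius_root hM
  have h2 := lt_secondRadius hM
  set r := secondRadius M
  have h3 : 0 < r := by linarith
  have h4 : 0 < (M - 1) * r - (M - 2) ^ 2 := by
    by_contra! h
    have h5 : 0 < (M - 1) * r := mul_pos (by linarith) h3
    by_cases h6 : 0 ≤ 2 * r - 1
    · nlinarith
    · linarith
  have h7 : a ^ 2 * (M - 1) ≤ (M - 2) ^ 2 * (1 + a) := by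
    have : 0 ≤ (M - 2 - a) * (M - 2 + a + a * (M - 2)) := by
      have : 0 ≤ M - 2 := by linarith
      have : 0 ≤ M - 2 - a := by linarith
      positivity
    nlinarith
  have h8 : a ^ 2 < (1 + a) * r := by
    have : (1 + a) * (M - 2) ^ 2 < (1 + a) * ((M - 1) * r) :=
      mul_lt_mul_of_pos_left (by linarith) (by linarith)
    have h9 : a ^ 2 * (M - 1) < (1 + a) * r * (M - 1) := by linarith
    exact lt_of_mul_lt_mul_right h9 (by linarith)
  have : a ^ 2 / r < 1 + a := by rwa [div_lt_iff₀ h3]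
  unfold pendantFactor
  linarith

/-- A product over an edge that meets all others. -/
theorem le_prod_pendantFactor {ι : Type*} {M : ℝ} (hM : 3 ≤ M)
    (s : Finset ι) (a : ι → ℝ) (ha : ∀ i ∈ s, a i = 0 ∨ 1 ≤ a i)
    (hs : ∑ i ∈ s, a i = M - 1) (hne : ∀ i ∈ s, a i ≠ M - 1) :
    (∀ i ∈ s, a i ≤ M - 2) ∧
    (M - 1) / secondRadius M ≤ ∏ i ∈ s, pendantFactor (secondRadius M) (a i) ∧
    ((M - 1) / secondRadius M = ∏ i ∈ s, pendantFactor (secondRadius M) (a i) →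
      ∃ i ∈ s, ∃ j ∈ s, i ≠ j ∧ a i = 1 ∧ a j = M - 2 ∧ ∀ l ∈ s, l ≠ i → l ≠ j → a l = 0) := by
  classical
  have h2 := lt_secondRadius hM
  have hpd := pendantFactor_secondRadius hM
  have hpp := fun a => pendantFactor_pos (a := a) hM
  set r := secondRadius M
  have hr : 0 < r := by linarith
  have ha0 : ∀ i ∈ s, 0 ≤ a i := fun i hi => (ha i hi).elim (fun h => h.ge) zero_le_one.trans
  have hrest : ∀ i ∈ s, a i + ∑ j ∈ s.erase i, a j = M - 1 := fun i hi => by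
    rw [Finset.add_sum_erase s a hi, hs]
  have hother : ∀ i ∈ s, ∃ j ∈ s.erase i, 1 ≤ a j ∧ a j ≤ ∑ l ∈ s.erase i, a l := by
    intro i hi
    refine (sum_eq_zero_or_one_le (s.erase i) a
      fun j hj => ha j (Finset.mem_of_mem_erase hj)).resolve_left fun h => ?_
    have := hrest i hi
    rw [Finset.sum_eq_zero h, add_zero] at this
    exact hne i hi this
  have hle : ∀ i ∈ s, a i ≤ M - 2 := by
    intro i hi
    obtain ⟨j, -, h1, h2⟩ := hother i hi
    linarith [hrest i hi]
  have hp : ∀ i ∈ s, 0 < pendantFactor r (a i) := fun i hi => hpp _ (ha0 i hi) (hle i hi)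
  refine ⟨hle, ?_⟩
  obtain ⟨i, hi, hi1, -⟩ := (sum_eq_zero_or_one_le s a ha).resolve_left fun h => by
    rw [Finset.sum_eq_zero h] at hs
    linarith
  obtain ⟨j, hj, hj1, hjs⟩ := hother i hi
  have hb := hrest i hi
  set b := ∑ l ∈ s.erase i, a l with hbdef
  -- All entries but `a i` are merged into `b`; the side condition is `M - 1 ≤ r + 2`, which follows
  -- from `r > M - 5/2`.
  have h5 := pendantFactor_one_mul_le hr hi1 (hj1.trans hjs) (by linarith)
  rw [show a i + b - 1 = M - 2 by linarith, hpd] at h5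
  have h6 : pendantFactor r b ≤ ∏ l ∈ s.erase i, pendantFactor r (a l) :=
    pendantFactor_sum_le_prod hr _ _ (fun l hl => ha0 l (Finset.mem_of_mem_erase hl))
      (fun l hl => (hp l (Finset.mem_of_mem_erase hl)).le) (by linarith)
  have h7 := mul_le_mul_of_nonneg_left h6 (hp i hi).le
  rw [Finset.mul_prod_erase s (fun l => pendantFactor r (a l)) hi] at h7
  refine ⟨h5.1.trans h7, fun heq => ?_⟩
  have hjs' := Finset.mem_of_mem_erase hj
  have hji := Finset.ne_of_mem_erase hj
  have hbj : b = a j + ∑ l ∈ (s.erase i).erase j, a l := by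
    rw [Finset.add_sum_erase _ a hj]
  -- A third nonzero entry would make the merging strict.
  have hzero : ∀ l ∈ (s.erase i).erase j, a l = 0 := by
    refine (sum_eq_zero_or_one_le _ a fun l hl =>
      ha l (Finset.mem_of_mem_erase (Finset.mem_of_mem_erase hl))).resolve_right ?_
    rintro ⟨l, hl, hl1, hls⟩
    have h8 : pendantFactor r b < ∏ l ∈ s.erase i, pendantFactor r (a l) := by
      rw [hbj, ← Finset.mul_prod_erase _ (fun l => pendantFactor r (a l)) hj]
      refine (pendantFactor_add_lt hr (by linarith) (by linarith) (by linarith)).trans_le ?_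
      refine mul_le_mul_of_nonneg_left ?_ (hp j hjs').le
      exact pendantFactor_sum_le_prod hr _ _
        (fun l hl => ha0 l (Finset.mem_of_mem_erase (Finset.mem_of_mem_erase hl)))
        (fun l hl => (hp l (Finset.mem_of_mem_erase (Finset.mem_of_mem_erase hl))).le)
        (by linarith)
    have h9 := mul_lt_mul_of_pos_left h8 (hp i hi)
    rw [Finset.mul_prod_erase s (fun l => pendantFactor r (a l)) hi] at h9
    linarith [h5.1]
  rw [Finset.sum_eq_zero hzero, add_zero] at hbj
  rcases h5.2 (le_antisymm h5.1 (heq ▸ h7)) with h | h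
  · exact ⟨i, hi, j, hjs', hji.symm, h, by linarith, fun l hl h1 h2 =>
      hzero l (Finset.mem_erase.2 ⟨h2, Finset.mem_erase.2 ⟨h1, hl⟩⟩)⟩
  · exact ⟨j, hjs', i, hi, hji, by linarith, by linarith, fun l hl h1 h2 =>
      hzero l (Finset.mem_erase.2 ⟨h1, Finset.mem_erase.2 ⟨h2, hl⟩⟩)⟩

/-! ### Labellings for an edge meeting all others, or all but one -/

namespace UniformHypergraph

variable {V : Type*} [DecidableEq V] {k : ℕ} {G : UniformHypergraph V k}

theorem one_le_degree_sub_one {e f : Finset V} (he : e ∈ G.edges) (hf : f ∈ G.edges)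
    (hef : e ≠ f) {i : V} (hie : i ∈ e) (hif : i ∈ f) : (1 : ℝ) ≤ (G.degree i : ℝ) - 1 := by
  rw [G.degree_sub_one he hie]
  have : 0 < ((G.edges.erase e).filter (fun f => i ∈ f)).card :=
    Finset.card_pos.2 ⟨f, Finset.mem_filter.2 ⟨Finset.mem_erase.2 ⟨hef.symm, hf⟩, hif⟩⟩
  exact_mod_cast this

/-- The degree of a vertex minus one is zero or at least one, on an edge. -/
theorem degree_sub_one_eq_zero_or {e : Finset V} (he : e ∈ G.edges) {i : V} (hi : i ∈ e) :
    (G.degree i : ℝ) - 1 = 0 ∨ (1 : ℝ) ≤ (G.degree i : ℝ) - 1 := by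
  rw [G.degree_sub_one he hi]
  rcases Nat.eq_zero_or_pos ((G.edges.erase e).filter (fun f => i ∈ f)).card with h | h
  · exact Or.inl (by rw [h, Nat.cast_zero])
  · exact Or.inr (by exact_mod_cast h)

/-- If all edges that meet `f` also meet `e`, then they meet `f` in its attaching vertex. -/
theorem IsHypertree.sum_degree_sub_one_of_pendant (hG : G.IsHypertree) {e f : Finset V}
    (he : e ∈ G.edges) (hf : f ∈ G.edges) (hfe : f ≠ e) {p : V} (hpe : p ∈ e) (hpf : p ∈ f)
    (h : ∀ g ∈ G.meeting f, ∃ x ∈ e, x ∈ g) :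
    ∑ i ∈ f, ((G.degree i : ℝ) - 1) = (G.degree p : ℝ) - 1 := by
  rw [hG.sum_degree_sub_one hf, G.degree_sub_one hf hpf]
  congr 2
  ext g
  rw [mem_meeting, Finset.mem_filter, Finset.mem_erase]
  constructor
  · rintro ⟨hgf, hg, y, hyf, hyg⟩
    refine ⟨⟨hgf, hg⟩, ?_⟩
    by_cases hge : g = e
    · exact hge ▸ hpe
    obtain ⟨x, hxe, hxg⟩ := h g (mem_meeting.2 ⟨hgf, hg, y, hyf, hyg⟩)
    exact hG.triangle he hf hg hfe.symm (Ne.symm hgf) hge hpe hpf hyf hyg hxg hxe ▸ hyg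
  · rintro ⟨⟨hgf, hg⟩, hpg⟩
    exact ⟨hgf, hg, p, hpf, hpg⟩

/-- By linearity `f` meets `e` in `p` only, so a single label of a pendant edge differs from `1`. -/
theorem IsHypertree.prod_ite_mem (hG : G.IsHypertree) {e f : Finset V}
    (he : e ∈ G.edges) (hf : f ∈ G.edges) (hfe : f ≠ e) {p : V} (hpe : p ∈ e) (hpf : p ∈ f)
    (b : V → ℝ) : ∏ i ∈ f, (if i ∈ e then b i else 1) = b p := by
  rw [Finset.prod_eq_single_of_mem p hpf, if_pos hpe]
  intro i hi hip
  exact if_neg fun hie => hip (hG.linear hf he hfe hi hie hpf hpe)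

theorem sum_const_erase {e : Finset V} (he : e ∈ G.edges) {i : V} (hi : i ∈ e) (b : ℝ) :
    ∑ _f ∈ (G.edges.filter (fun f => i ∈ f)).erase e, b = ((G.degree i : ℝ) - 1) * b := by
  rw [Finset.sum_const, nsmul_eq_mul, ← Finset.filter_erase, ← G.degree_sub_one he hi]

/-- The labelling for an edge `e` that meets all other edges. -/
noncomputable def centralLabel (G : UniformHypergraph V k) (r : ℝ) (e : Finset V) (i : V)
    (f : Finset V) : ℝ :=
  if f = e then pendantFactor r ((G.degree i : ℝ) - 1)
  else if i ∈ e then ((G.degree i : ℝ) - 1) / r else 1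

theorem IsHypertree.centralLabel_facts (hG : G.IsHypertree) {e : Finset V} (he : e ∈ G.edges)
    (hall : ∀ f ∈ G.edges, f ≠ e → ∃ x ∈ e, x ∈ f) {r : ℝ} (hr : 0 < r)
    (hp : ∀ i ∈ e, 0 < pendantFactor r ((G.degree i : ℝ) - 1)) :
    (∀ f ∈ G.edges, ∀ i ∈ f, 0 < G.centralLabel r e i f) ∧
    (∀ i, ∑ f ∈ G.edges.filter (fun f => i ∈ f), G.centralLabel r e i f = G.degree i) ∧
    (∀ f ∈ G.edges, f ≠ e →
      ∑ i ∈ f, ((G.degree i : ℝ) - 1) = r * ∏ i ∈ f, G.centralLabel r e i f) ∧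
    ∏ i ∈ e, G.centralLabel r e i e = ∏ i ∈ e, pendantFactor r ((G.degree i : ℝ) - 1) := by
  refine ⟨?_, ?_, ?_, ?_⟩
  · intro f hf i hi
    unfold centralLabel
    split_ifs with h1 h2
    · exact hp i (h1 ▸ hi)
    · have := one_le_degree_sub_one hf he h1 hi h2
      positivity
    · exact one_pos
  · intro i
    by_cases hi : i ∈ e
    -- With `a = d_i - 1`, the `a` other edges at `i` take `a / r` each; the pendant factor is what
    -- remains of `1 + a`.
    · rw [← Finset.add_sum_erase _ _ (Finset.mem_filter.2 ⟨he, hi⟩)]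
      rw [Finset.sum_congr rfl (g := fun _ => ((G.degree i : ℝ) - 1) / r), sum_const_erase he hi]
      · simp only [centralLabel, if_true, pendantFactor]
        ring
      · intro f hf
        simp [centralLabel, Finset.ne_of_mem_erase hf, hi]
    · rw [Finset.sum_congr rfl (g := fun _ => (1 : ℝ))]
      · simp [degree]
      · intro f hf
        have : f ≠ e := fun h => hi (h ▸ (Finset.mem_filter.1 hf).2)
        simp [centralLabel, this, hi]
  · intro f hf hfe
    obtain ⟨p, hpe, hpf⟩ := hall f hf hfe
    rw [hG.sum_degree_sub_one_of_pendant he hf hfe hpe hpf]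
    · simp only [centralLabel, if_neg hfe]
      rw [hG.prod_ite_mem he hf hfe hpe hpf (fun i => ((G.degree i : ℝ) - 1) / r)]
      field_simp
    · intro g hg
      by_cases hge : g = e
      · exact ⟨p, hpe, hge ▸ hpe⟩
      · exact hall g (mem_meeting.1 hg).2.1 hge
  · simp [centralLabel]

theorem IsHypertree.abcSpectralRadius_le_of_central [Fintype V] [Nonempty V]
    (hk : 2 ≤ k) (hG : G.IsHypertree)
    {e : Finset V} (he : e ∈ G.edges) (hall : ∀ f ∈ G.edges, f ≠ e → ∃ x ∈ e, x ∈ f) {r : ℝ}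
    (hr : 0 < r) (hp : ∀ i ∈ e, 0 < pendantFactor r ((G.degree i : ℝ) - 1))
    (hle : ∑ i ∈ e, ((G.degree i : ℝ) - 1) ≤
      r * ∏ i ∈ e, pendantFactor r ((G.degree i : ℝ) - 1)) :
    G.abcSpectralRadius ≤ r ^ (1 / (k : ℝ)) ∧ (G.abcSpectralRadius = r ^ (1 / (k : ℝ)) →
      ∑ i ∈ e, ((G.degree i : ℝ) - 1) =
        r * ∏ i ∈ e, pendantFactor r ((G.degree i : ℝ) - 1)) := by
  obtain ⟨h1, h2, h3, h4⟩ := hG.centralLabel_facts he hall hr hp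
  have h := abcSpectralRadius_le_of_labelling hk hG.1 hr (G.centralLabel r e) h1
    (fun i => (h2 i).le) (fun f hf => by
      by_cases hfe : f = e
      · rw [hfe, h4]
        exact hle
      · exact (h3 f hf hfe).le)
  exact ⟨h.1, fun heq => h4 ▸ h.2 heq e he⟩

theorem IsHypertree.le_abcSpectralRadius_of_central [Fintype V] [Nonempty V]
    (hk : 2 ≤ k) (hG : G.IsHypertree)
    {e : Finset V} (he : e ∈ G.edges) (hall : ∀ f ∈ G.edges, f ≠ e → ∃ x ∈ e, x ∈ f) {r : ℝ}
    (hr : 0 < r) (hp : ∀ i ∈ e, 0 < pendantFactor r ((G.degree i : ℝ) - 1))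
    (heq : ∑ i ∈ e, ((G.degree i : ℝ) - 1) =
      r * ∏ i ∈ e, pendantFactor r ((G.degree i : ℝ) - 1)) :
    r ^ (1 / (k : ℝ)) ≤ G.abcSpectralRadius := by
  obtain ⟨h1, h2, h3, h4⟩ := hG.centralLabel_facts he hall hr hp
  choose! p hpe hpf using hall
  choose F hF hiF using fun i => hG.1.exists_edge hk ⟨e, he⟩ i
  set a : V → ℝ := fun i => (G.degree i : ℝ) - 1 with ha
  -- Normalising `c e = 1` forces `y = 1 / pendantFactor` on `e`; the attaching vertex `p f` then
  -- determines `c f`, and the labels `1` outside `e` make `y` equal to `c f` there.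
  set c : Finset V → ℝ := fun f => if f = e then 1 else a (p f) / r / pendantFactor r (a (p f))
    with hc
  have hFe : ∀ i, i ∉ e → F i ≠ e := fun i hi h => hi (h ▸ hiF i)
  -- Two edges through `i` would form a triangle with `e`, which puts `i` into `e`.
  have hFu : ∀ i, i ∉ e → ∀ f ∈ G.edges, i ∈ f → F i = f := by
    intro i hi f hf hif
    by_contra hne
    have hfe : f ≠ e := fun h => hi (h ▸ hif)
    have := hG.triangle he (hF i) hf (hFe i hi).symm hne hfe (hpe _ (hF i) (hFe i hi))
      (hpf _ (hF i) (hFe i hi)) (hiF i) hif (hpf f hf hfe) (hpe f hf hfe)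
    exact hi (this ▸ hpe _ (hF i) (hFe i hi))
  refine le_abcSpectralRadius_of_labelling hk G hr.le (G.centralLabel r e) h1 ?_ h2 ?_
    (fun i => if i ∈ e then 1 / pendantFactor r (a i) else c (F i)) ?_ c ?_
  · intro i
    exact Finset.card_pos.2 ⟨F i, Finset.mem_filter.2 ⟨hF i, hiF i⟩⟩
  · intro f hf
    by_cases hfe : f = e
    · rw [hfe, h4]
      exact heq
    · exact h3 f hf hfe
  · intro i
    by_cases hi : i ∈ e
    · rw [if_pos hi]
      exact one_div_pos.2 (hp i hi)
    · rw [if_neg hi]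
      simp only [hc, if_neg (hFe i hi)]
      have h5 := one_le_degree_sub_one he (hF i) (hFe i hi).symm (hpe _ (hF i) (hFe i hi))
        (hpf _ (hF i) (hFe i hi))
      have h6 := hp _ (hpe _ (hF i) (hFe i hi))
      have h7 : 0 < a (p (F i)) := zero_lt_one.trans_le h5
      exact div_pos (div_pos h7 hr) h6
  · intro f hf i hi
    by_cases hfe : f = e
    · subst hfe
      have := (hp i hi).ne'
      simp only [centralLabel, hc, if_true, if_pos hi]
      field_simp
      exact div_self this
    · simp only [centralLabel, hc, if_neg hfe]
      by_cases hie : i ∈ e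
      · rw [if_pos hie, if_pos hie, hG.linear he hf (Ne.symm hfe) hie hi (hpe f hf hfe)
          (hpf f hf hfe)]
        ring
      · rw [if_neg hie, if_neg hie, hFu i hie f hf hi, if_neg hfe, one_mul]

/-- The labelling for an edge `e` that meets all other edges but one, `f₂`, which is attached at
`u` to the edge `f₁`, which is attached at `v` to `e`. -/
noncomputable def twigLabel (G : UniformHypergraph V k) (r : ℝ) (e f₁ f₂ : Finset V) (v u : V)
    (i : V) (f : Finset V) : ℝ :=
  if f = e then
    if i = v then
      (G.degree v : ℝ) - ((G.degree v : ℝ) - 2) * ((G.degree v : ℝ) - 1) / r -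
        G.degree v / (2 * r - 1)
    else pendantFactor r ((G.degree i : ℝ) - 1)
  else if f = f₁ then
    if i = v then G.degree v / (2 * r - 1) else if i = u then 2 - 1 / r else 1
  else if f = f₂ then if i = u then 1 / r else 1
  else if i ∈ e then ((G.degree i : ℝ) - 1) / r else 1

/-- The labels are found from the outside in: `f₂` needs `1 / r` at `u`, leaving `2 - 1 / r` there
for `f₁`; as at most `d_v` edges meet `f₁`, it is enough to give it `d_v / (2 r - 1)` at `v`. What
is left at `v` goes to `e`. A strict condition at `e` alone excludes equality of the radius. -/
theorem IsHypertree.abcSpectralRadius_lt_of_twig [Fintype V] [Nonempty V]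
    (hk : 2 ≤ k) (hG : G.IsHypertree)
    {e f₁ f₂ : Finset V} (he : e ∈ G.edges) (hf₁ : f₁ ∈ G.edges) (hf₂ : f₂ ∈ G.edges)
    (hd : Disjoint e f₂) {v u : V} (hve : v ∈ e) (hvf : v ∈ f₁) (huf₁ : u ∈ f₁) (huf₂ : u ∈ f₂)
    (hall : ∀ f ∈ G.edges, f ≠ e → f ≠ f₂ → ∃ x ∈ e, x ∈ f) {r : ℝ} (hr : 1 / 2 < r)
    (hp : ∀ i ∈ e, 0 < pendantFactor r ((G.degree i : ℝ) - 1))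
    (hv : 0 < (G.degree v : ℝ) - ((G.degree v : ℝ) - 2) * ((G.degree v : ℝ) - 1) / r -
        G.degree v / (2 * r - 1))
    (hlt : ∑ i ∈ e, ((G.degree i : ℝ) - 1) <
      r * (((G.degree v : ℝ) - ((G.degree v : ℝ) - 2) * ((G.degree v : ℝ) - 1) / r -
        G.degree v / (2 * r - 1)) *
          ∏ i ∈ e.erase v, pendantFactor r ((G.degree i : ℝ) - 1))) :
    G.abcSpectralRadius < r ^ (1 / (k : ℝ)) := by
  have hr0 : 0 < r := by linarith
  have hr1 : 0 < 2 * r - 1 := by linarith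
  have hdl := Finset.disjoint_left.1 hd
  have n1 : f₁ ≠ e := fun h => hdl (h ▸ huf₁) huf₂
  have n2 : f₂ ≠ e := fun h => hdl hve (h ▸ hve)
  have n3 : f₁ ≠ f₂ := fun h => hdl hve (h ▸ hvf)
  have hue : u ∉ e := fun h => hdl h huf₂
  have hvu : u ≠ v := fun h => hue (h ▸ hve)
  -- Any edge meeting `f₂` also meets `e`, and only one edge can meet both of these disjoint edges.
  have hmeet : ∀ g ∈ G.edges, g ≠ f₂ → ∀ x ∈ f₂, x ∈ g → g = f₁ := by
    intro g hg hg2 x hx hxg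
    have hge : g ≠ e := fun h => hdl (h ▸ hxg) hx
    obtain ⟨y, hye, hyg⟩ := hall g hg hge hg2
    exact hG.eq_of_meet_disjoint he hg hf₂ hf₁ hd hye hyg hxg hx huf₂ huf₁ hvf hve
  have hdu : G.edges.filter (fun f => u ∈ f) = {f₁, f₂} := by
    ext g
    rw [Finset.mem_filter, Finset.mem_insert, Finset.mem_singleton]
    constructor
    · rintro ⟨hg, hug⟩
      by_cases h : g = f₂
      · exact Or.inr h
      · exact Or.inl (hmeet g hg h u huf₂ hug)
    · rintro (rfl | rfl)
      · exact ⟨hf₁, huf₁⟩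
      · exact ⟨hf₂, huf₂⟩
  have hpos : ∀ f ∈ G.edges, ∀ i ∈ f, 0 < G.twigLabel r e f₁ f₂ v u i f := by
    intro f hf i hi
    unfold twigLabel
    split_ifs with h1 h2 h3 h4 h5 h6 h7 h8
    · exact hv
    · exact hp i (h1 ▸ hi)
    · have := G.one_le_degree he hve
      positivity
    · rw [sub_pos, div_lt_iff₀ hr0]
      linarith
    · exact one_pos
    · positivity
    · exact one_pos
    · have := one_le_degree_sub_one hf he h1 hi h8
      positivity
    · exact one_pos
  have hsum : ∀ i, ∑ f ∈ G.edges.filter (fun f => i ∈ f), G.twigLabel r e f₁ f₂ v u i f ≤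
      G.degree i := by
    intro i
    by_cases hiv : i = v
    · subst hiv
      rw [← Finset.add_sum_erase _ _ (Finset.mem_filter.2 ⟨he, hve⟩),
        ← Finset.add_sum_erase _ _ (Finset.mem_erase.2 ⟨n1, Finset.mem_filter.2 ⟨hf₁, hvf⟩⟩),
        Finset.sum_congr rfl (g := fun _ => ((G.degree i : ℝ) - 1) / r)]
      · have h := sum_const_erase he hve (((G.degree i : ℝ) - 1) / r)
        rw [← Finset.add_sum_erase _ _
          (Finset.mem_erase.2 ⟨n1, Finset.mem_filter.2 ⟨hf₁, hvf⟩⟩)] at h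
        simp only [twigLabel, if_true, if_neg n1]
        refine le_of_eq ?_
        linear_combination h
      · intro f hf
        rw [Finset.mem_erase, Finset.mem_erase, Finset.mem_filter] at hf
        have : f ≠ f₂ := fun h => hdl hve (h ▸ hf.2.2.2)
        simp [twigLabel, hf.1, hf.2.1, this, hve]
    by_cases hie : i ∈ e
    · rw [← Finset.add_sum_erase _ _ (Finset.mem_filter.2 ⟨he, hie⟩),
        Finset.sum_congr rfl (g := fun _ => ((G.degree i : ℝ) - 1) / r), sum_const_erase he hie]
      · simp only [twigLabel, if_true, pendantFactor, if_neg hiv]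
        refine le_of_eq ?_
        ring
      · intro f hf
        rw [Finset.mem_erase, Finset.mem_filter] at hf
        have h2 : f ≠ f₂ := fun h => hdl hie (h ▸ hf.2.2)
        have h1 : f ≠ f₁ := fun h =>
          hiv (hG.linear he hf₁ n1.symm hie (h ▸ hf.2.2) hve hvf)
        simp [twigLabel, hf.1, h1, h2, hie]
    by_cases hiu : i = u
    · subst hiu
      rw [degree, hdu, Finset.sum_pair n3, Finset.card_pair n3]
      simp [twigLabel, n1, n2, n3.symm, hiv]
    · rw [Finset.sum_congr rfl (g := fun _ => (1 : ℝ))]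
      · simp [degree]
      · intro f hf
        have : f ≠ e := fun h => hie (h ▸ (Finset.mem_filter.1 hf).2)
        simp [twigLabel, this, hie, hiv, hiu]
  have hve' : ∏ i ∈ e, G.twigLabel r e f₁ f₂ v u i e =
      ((G.degree v : ℝ) - ((G.degree v : ℝ) - 2) * ((G.degree v : ℝ) - 1) / r -
        G.degree v / (2 * r - 1)) *
          ∏ i ∈ e.erase v, pendantFactor r ((G.degree i : ℝ) - 1) := by
    rw [← Finset.mul_prod_erase _ _ hve]
    congr 1
    · simp [twigLabel]
    · refine Finset.prod_congr rfl fun i hi => ?_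
      simp [twigLabel, Finset.ne_of_mem_erase hi]
  have hprod : ∀ f ∈ G.edges,
      ∑ i ∈ f, ((G.degree i : ℝ) - 1) ≤ r * ∏ i ∈ f, G.twigLabel r e f₁ f₂ v u i f := by
    intro f hf
    by_cases hfe : f = e
    · subst hfe
      rw [hve']
      exact hlt.le
    by_cases h1 : f = f₁
    · subst h1
      have hP : ∏ i ∈ f, G.twigLabel r e f f₂ v u i f =
          G.degree v / (2 * r - 1) * (2 - 1 / r) := by
        rw [← Finset.mul_prod_erase _ _ hvf,
          ← Finset.mul_prod_erase _ _ (Finset.mem_erase.2 ⟨hvu, huf₁⟩), Finset.prod_eq_one]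
        · simp [twigLabel, n1, hvu]
        · intro i hi
          rw [Finset.mem_erase, Finset.mem_erase] at hi
          simp [twigLabel, n1, hi.1, hi.2.1]
      have hN : G.meeting f ⊆ insert f₂ ((G.edges.erase f).filter (fun g => v ∈ g)) := by
        intro g hg
        obtain ⟨hgf, hg, y, hyf, hyg⟩ := mem_meeting.1 hg
        rw [Finset.mem_insert, Finset.mem_filter, Finset.mem_erase]
        by_cases hg2 : g = f₂
        · exact Or.inl hg2
        refine Or.inr ⟨⟨hgf, hg⟩, ?_⟩
        by_cases hge : g = e
        · exact hge ▸ hve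
        obtain ⟨x, hxe, hxg⟩ := hall g hg hge hg2
        exact hG.triangle he hf hg (Ne.symm hfe) (Ne.symm hgf) hge hve hvf hyf hyg hxg hxe ▸ hyg
      have hc := (Finset.card_le_card hN).trans (Finset.card_insert_le _ _)
      have hc' : ((G.meeting f).card : ℝ) ≤ (G.degree v : ℝ) := by
        have h := G.degree_sub_one hf hvf
        have : ((G.meeting f).card : ℝ) ≤
            ((G.edges.erase f).filter (fun g => v ∈ g)).card + 1 := by exact_mod_cast hc
        linarith
      have h5 : r * 2 - 1 ≠ 0 := by linarith
      rw [hP, hG.sum_degree_sub_one hf]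
      refine hc'.trans (le_of_eq ?_)
      field_simp
    by_cases h2 : f = f₂
    · subst h2
      have hP : ∏ i ∈ f, G.twigLabel r e f₁ f v u i f = 1 / r := by
        rw [Finset.prod_eq_single_of_mem u huf₂]
        · simp [twigLabel, n2, n3.symm]
        · intro i _ hi
          simp [twigLabel, n2, n3.symm, hi]
      have hN : G.meeting f ⊆ {f₁} := by
        intro g hg
        obtain ⟨hgf, hg, y, hyf, hyg⟩ := mem_meeting.1 hg
        exact Finset.mem_singleton.2 (hmeet g hg hgf y hyf hyg)
      have hc := Finset.card_le_card hN
      rw [Finset.card_singleton] at hc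
      have hc' : ((G.meeting f).card : ℝ) ≤ 1 := by exact_mod_cast hc
      rw [hP, hG.sum_degree_sub_one hf]
      refine hc'.trans (le_of_eq ?_)
      field_simp
    obtain ⟨p, hpe, hpf⟩ := hall f hf hfe h2
    rw [hG.sum_degree_sub_one_of_pendant he hf hfe hpe hpf]
    · simp only [twigLabel, if_neg hfe, if_neg h1, if_neg h2]
      rw [hG.prod_ite_mem he hf hfe hpe hpf (fun i => ((G.degree i : ℝ) - 1) / r)]
      refine le_of_eq ?_
      field_simp
    · intro g hg
      obtain ⟨hgf, hg, y, hyf, hyg⟩ := mem_meeting.1 hg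
      by_cases hge : g = e
      · exact ⟨p, hpe, hge ▸ hpe⟩
      refine hall g hg hge fun h => ?_
      subst h
      exact h1 (hmeet f hf h2 y hyg hyf)
  have h := abcSpectralRadius_le_of_labelling hk hG.1 hr0 _ hpos hsum hprod
  refine lt_of_le_of_ne h.1 fun heq => ?_
  have := h.2 heq e he
  rw [hve'] at this
  exact hlt.ne this

end UniformHypergraph

/-! ### The strict inequality for an edge that misses one other edge -/

theorem one_lt_pendantFactor {M : ℝ} (hM : 4 ≤ M) :
    1 < pendantFactor (secondRadius M) (M - 3) := by
  have h2 := lt_secondRadius (M := M) (by linarith)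
  have hr : 0 < secondRadius M := by linarith
  have : (M - 3) ^ 2 / secondRadius M < M - 3 := by
    rw [div_lt_iff₀ hr]
    nlinarith
  unfold pendantFactor
  linarith

/-- The inequality for an edge that meets all other edges but one. -/
theorem lt_mul_prod_pendantFactor {ι : Type*} [DecidableEq ι] {M : ℝ} (hM : M = 4 ∨ 5 ≤ M)
    (s : Finset ι) (a : ι → ℝ) (ha : ∀ i ∈ s, a i = 0 ∨ 1 ≤ a i)
    (hs : ∑ i ∈ s, a i = M - 2) {v : ι} (hv : v ∈ s) (hv1 : a v = 1 ∨ 2 ≤ a v)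
    (hvM : a v ≤ M - 3) :
    0 < 1 + a v - (a v - 1) * a v / secondRadius M - (1 + a v) / (2 * secondRadius M - 1) ∧
    M - 2 < secondRadius M *
      ((1 + a v - (a v - 1) * a v / secondRadius M - (1 + a v) / (2 * secondRadius M - 1)) *
        ∏ i ∈ s.erase v, pendantFactor (secondRadius M) (a i)) := by
  have hM4 : 4 ≤ M := by rcases hM with h | h <;> linarith
  have hM3 : 3 ≤ M := by linarith
  have h2 := lt_secondRadius hM3
  have hpp := fun a => pendantFactor_pos (a := a) hM3
  have h1 := one_lt_pendantFactor hM4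
  have h4 : M = 4 → secondRadius M = 2 := by
    rintro rfl
    exact secondRadius_four
  set r := secondRadius M
  have hr : 0 < r := by linarith
  have hr1 : 0 < 2 * r - 1 := by linarith
  have ha0 : ∀ i ∈ s, 0 ≤ a i := fun i hi => (ha i hi).elim (fun h => h.ge) zero_le_one.trans
  have hle : ∀ i ∈ s, a i ≤ M - 2 := fun i hi => hs ▸ Finset.single_le_sum ha0 hi
  have hb : a v + ∑ i ∈ s.erase v, a i = M - 2 := by rw [Finset.add_sum_erase s a hv, hs]
  set b := ∑ i ∈ s.erase v, a i
  have hprod : pendantFactor r b ≤ ∏ i ∈ s.erase v, pendantFactor r (a i) :=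
    pendantFactor_sum_le_prod hr _ _ (fun l hl => ha0 l (Finset.mem_of_mem_erase hl))
      (fun l hl => (hpp _ (ha0 l (Finset.mem_of_mem_erase hl))
        (hle l (Finset.mem_of_mem_erase hl))).le) (show b ≤ r + 2 by linarith [ha0 v hv])
  set P := ∏ i ∈ s.erase v, pendantFactor r (a i)
  rcases hv1 with hv1 | hv2
  · rw [hv1] at hb ⊢
    rw [show b = M - 3 by linarith] at hprod
    have hP : 1 < P := h1.trans_le hprod
    have hg : (1 : ℝ) + 1 - (1 - 1) * 1 / r - (1 + 1) / (2 * r - 1) =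
        4 * (r - 1) / (2 * r - 1) := by
      rw [eq_div_iff hr1.ne', sub_mul, div_mul_cancel₀ _ hr1.ne']
      ring
    rw [hg]
    have hr2 : 1 < r := by
      rcases hM with h | h
      · rw [h4 h]
        norm_num
      · linarith
    have hg0 : 0 < 4 * (r - 1) / (2 * r - 1) := div_pos (by linarith) hr1
    refine ⟨hg0, ?_⟩
    -- For `a v = 1` the leftover at `v` alone reaches `M - 2`; strictness comes from `P > 1`.
    have h5 : M - 2 ≤ r * (4 * (r - 1) / (2 * r - 1)) := by
      rw [← mul_div_assoc, le_div_iff₀ hr1]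
      rcases hM with h | h
      · rw [h4 h, h]
        norm_num
      · nlinarith
    rw [← mul_assoc]
    have h6 : 0 < r * (4 * (r - 1) / (2 * r - 1)) := mul_pos hr hg0
    nlinarith
  · have hr2 : 2 < r := by
      rcases hM with h | h <;> linarith
    -- For `a v ≥ 2` and `r > 2` the edge carrying the twig takes no more at `v` than a pendant edge
    -- would, so the plain pendant factor is a lower bound.
    have hg : pendantFactor r (a v) ≤
        1 + a v - (a v - 1) * a v / r - (1 + a v) / (2 * r - 1) := by
      have h5 : (1 + a v) / (2 * r - 1) ≤ a v / r := by
        rw [div_le_div_iff₀ hr1 hr]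
        nlinarith
      have h6 : (a v - 1) * a v / r = a v ^ 2 / r - a v / r := by ring
      unfold pendantFactor
      linarith
    have hg0 := hpp (a v) (ha0 v hv) (hle v hv)
    refine ⟨hg0.trans_le hg, ?_⟩
    have h5 := (pendantFactor_one_mul_le (a := a v) (b := b) hr (by linarith) (by linarith)
      (by linarith)).1
    rw [show a v + b - 1 = M - 3 by linarith] at h5
    have hP0 : 0 < pendantFactor r b := hpp _ (by linarith) (by linarith)
    have h6 : pendantFactor r (a v) * pendantFactor r b ≤
        (1 + a v - (a v - 1) * a v / r - (1 + a v) / (2 * r - 1)) * P :=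
      mul_le_mul hg hprod hP0.le (hg0.le.trans hg)
    have h7 : r * pendantFactor r 1 = 2 * r - 1 := by
      unfold pendantFactor
      field_simp
      ring
    calc M - 2 ≤ 2 * r - 1 := by linarith
      _ < (2 * r - 1) * pendantFactor r (M - 3) := lt_mul_of_one_lt_right hr1 h1
      _ = r * (pendantFactor r 1 * pendantFactor r (M - 3)) := by rw [← h7, mul_assoc]
      _ ≤ _ := mul_le_mul_of_nonneg_left (h5.trans h6) hr.le

/-! ### Comparison of a hypertree with the two radii -/

namespace UniformHypergraph

/-- The edge `e` meets all other edges; they are attached at two vertices of `e`, one of them at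
the first vertex, and the others at the second one. -/
def IsDoubleStarAt {V : Type*} [DecidableEq V] {k : ℕ} (G : UniformHypergraph V k) (m : ℕ)
    (e : Finset V) (i j : V) : Prop :=
  e ∈ G.edges ∧ i ∈ e ∧ j ∈ e ∧ i ≠ j ∧ G.degree i = 2 ∧ G.degree j + 1 = m ∧
    (∀ l ∈ e, l ≠ i → l ≠ j → G.degree l = 1) ∧ ∀ f ∈ G.edges, f ≠ e → ∃ x ∈ e, x ∈ f

variable {V : Type*} [DecidableEq V] {k : ℕ} {G : UniformHypergraph V k}

theorem card_meeting_lt {e : Finset V} (he : e ∈ G.edges) :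
    (G.meeting e).card + 1 ≤ G.edges.card := by
  rw [← Finset.card_erase_add_one he]
  exact Nat.add_le_add_right (Finset.card_filter_le _ _) 1

theorem meets_of_card_meeting {e : Finset V} (he : e ∈ G.edges)
    (h : (G.meeting e).card + 1 = G.edges.card) : ∀ f ∈ G.edges, f ≠ e → ∃ x ∈ e, x ∈ f := by
  rw [← Finset.card_erase_add_one he] at h
  have := Finset.eq_of_subset_of_card_le (Finset.filter_subset _ (G.edges.erase e))
    (Nat.add_right_cancel h).ge
  intro f hf hfe
  exact Finset.not_disjoint_iff.1
    (Finset.filter_eq_self.1 this f (Finset.mem_erase.2 ⟨hfe, hf⟩))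

theorem common_of_degree_eq {i : V}
    (h : G.degree i = G.edges.card) : ∀ f ∈ G.edges, i ∈ f := by
  have := Finset.eq_of_subset_of_card_le (Finset.filter_subset (fun f => i ∈ f) G.edges) h.ge
  exact fun f hf => Finset.filter_eq_self.1 this f hf

/-- The constant labelling `1` has vertex sums `d_i`, and its edge condition compares the number of
neighbouring edges with `r`. -/
theorem IsHypertree.abcSpectralRadius_le_of_card_meeting [Fintype V] [Nonempty V] (hk : 2 ≤ k)
    (hG : G.IsHypertree) {r : ℝ} (hr : 0 < r)
    (h : ∀ e ∈ G.edges, ((G.meeting e).card : ℝ) ≤ r) :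
    G.abcSpectralRadius ≤ r ^ (1 / (k : ℝ)) ∧ (G.abcSpectralRadius = r ^ (1 / (k : ℝ)) →
      ∀ e ∈ G.edges, ((G.meeting e).card : ℝ) = r) := by
  have h1 := abcSpectralRadius_le_of_labelling hk hG.1 hr (fun _ _ => 1)
    (fun _ _ _ _ => one_pos) (fun i => by simp [degree])
    (fun e he => by
      rw [hG.sum_degree_sub_one he, Finset.prod_const_one, mul_one]
      exact h e he)
  refine ⟨h1.1, fun heq e he => ?_⟩
  have := h1.2 heq e he
  rwa [hG.sum_degree_sub_one he, Finset.prod_const_one, mul_one] at this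

/-- The constant labelling is consistent with `y = c = 1`; the eigenvector is `x_i = d_i^{1/k}`. -/
theorem IsHypertree.le_abcSpectralRadius_of_card_meeting [Fintype V] [Nonempty V] (hk : 2 ≤ k)
    (hG : G.IsHypertree) (hE : G.edges.Nonempty) {r : ℝ} (hr : 0 ≤ r)
    (h : ∀ e ∈ G.edges, ((G.meeting e).card : ℝ) = r) :
    r ^ (1 / (k : ℝ)) ≤ G.abcSpectralRadius := by
  refine le_abcSpectralRadius_of_labelling hk G hr (fun _ _ => 1) (fun _ _ _ _ => one_pos)
    (fun i => ?_) (fun i => by simp [degree])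
    (fun e he => by
      rw [hG.sum_degree_sub_one he, Finset.prod_const_one, mul_one]
      exact h e he)
    (fun _ => 1) (fun _ => one_pos) (fun _ => 1) (fun _ _ _ _ => one_mul 1)
  obtain ⟨e, he, hi⟩ := hG.1.exists_edge hk hE i
  exact Finset.card_pos.2 ⟨e, Finset.mem_filter.2 ⟨he, hi⟩⟩

theorem IsHypertree.abcSpectralRadius_le_secondRadius [Fintype V] [Nonempty V] (hk : 2 ≤ k)
    (hG : G.IsHypertree) {m : ℕ} (hm : 3 ≤ m) (hsize : G.edges.card = m)
    (hns : ¬ ∃ c, ∀ e ∈ G.edges, c ∈ e) :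
    G.abcSpectralRadius ≤ secondRadius m ^ (1 / (k : ℝ)) ∧
      (G.abcSpectralRadius = secondRadius m ^ (1 / (k : ℝ)) →
        ∃ e i j, G.IsDoubleStarAt m e i j) := by
  have hM : (3 : ℝ) ≤ m := by exact_mod_cast hm
  have hlr := lt_secondRadius hM
  have hr : 0 < secondRadius m := by linarith
  have ha : ∀ e ∈ G.edges, ∀ i ∈ e, (G.degree i : ℝ) - 1 = 0 ∨ (1 : ℝ) ≤ (G.degree i : ℝ) - 1 :=
    fun e he i hi => degree_sub_one_eq_zero_or he hi
  by_cases h1 : ∃ e ∈ G.edges, (G.meeting e).card + 1 = m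
  · obtain ⟨e, he, hem⟩ := h1
    have hall := meets_of_card_meeting he (hem.trans hsize.symm)
    have hs : ∑ i ∈ e, ((G.degree i : ℝ) - 1) = m - 1 := by
      rw [hG.sum_degree_sub_one he, ← hem]
      push_cast
      ring
    -- Such a vertex would have degree `m` and lie in all edges.
    have hne : ∀ i ∈ e, (G.degree i : ℝ) - 1 ≠ m - 1 := by
      intro i _ h
      refine hns ⟨i, common_of_degree_eq ?_⟩
      rw [hsize]
      exact_mod_cast sub_left_injective h
    obtain ⟨h2, h3, h4⟩ := le_prod_pendantFactor hM e _ (ha e he) hs hne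
    rw [div_le_iff₀' hr] at h3
    have h5 := hG.abcSpectralRadius_le_of_central hk he hall hr (fun i hi =>
      pendantFactor_pos hM ((ha e he i hi).elim (fun h => h.ge) zero_le_one.trans) (h2 i hi))
      (hs ▸ h3)
    refine ⟨h5.1, fun heq => ?_⟩
    have h6 := h5.2 heq
    obtain ⟨i, hi, j, hj, hij, hi1, hj1, hl⟩ := h4 (by
      rw [div_eq_iff hr.ne', ← hs, h6]
      ring)
    refine ⟨e, i, j, he, hi, hj, hij, ?_, ?_, fun l hle hli hlj => ?_, hall⟩
    · have : (G.degree i : ℝ) = 2 := by linarith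
      exact_mod_cast this
    · have : (G.degree j : ℝ) + 1 = m := by linarith
      exact_mod_cast this
    · have : (G.degree l : ℝ) = 1 := by linarith [hl l hle hli hlj]
      exact_mod_cast this
  push Not at h1
  have hle2 : ∀ e ∈ G.edges, (G.meeting e).card + 2 ≤ m := fun e he => by
    have := card_meeting_lt he
    have := h1 e he
    omega
  suffices hlt : G.abcSpectralRadius < secondRadius m ^ (1 / (k : ℝ)) from
    ⟨hlt.le, fun h => absurd h hlt.ne⟩
  by_cases h2 : ∃ e ∈ G.edges, (G.meeting e).card + 2 = m
  · obtain ⟨e, he, hem⟩ := h2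
    have hcard : ((G.edges.erase e) \ G.meeting e).card = 1 := by
      have hsub : G.meeting e ⊆ G.edges.erase e := Finset.filter_subset _ _
      rw [Finset.card_sdiff_of_subset hsub, Finset.card_erase_of_mem he]
      omega
    obtain ⟨f₂, hf₂s⟩ := Finset.card_eq_one.1 hcard
    have hmem : ∀ f, f ∈ G.edges → f ≠ e → f ∉ G.meeting e → f = f₂ := fun f hf hfe hfm =>
      Finset.mem_singleton.1 (hf₂s ▸ Finset.mem_sdiff.2 ⟨Finset.mem_erase.2 ⟨hfe, hf⟩, hfm⟩)
    have hf₂' : f₂ ∈ (G.edges.erase e) \ G.meeting e := hf₂s ▸ Finset.mem_singleton_self _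
    obtain ⟨hf₂e, hf₂m⟩ := Finset.mem_sdiff.1 hf₂'
    obtain ⟨hf₂e, hf₂⟩ := Finset.mem_erase.1 hf₂e
    have hd : Disjoint e f₂ := by
      by_contra h
      exact hf₂m (Finset.mem_filter.2 ⟨Finset.mem_erase.2 ⟨hf₂e, hf₂⟩, h⟩)
    have hdl := Finset.disjoint_left.1 hd
    have hall : ∀ f ∈ G.edges, f ≠ e → f ≠ f₂ → ∃ x ∈ e, x ∈ f := by
      intro f hf hfe hff
      by_contra h
      exact hff (hmem f hf hfe fun hfm => h (mem_meeting.1 hfm).2.2)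
    -- By connectedness the missed edge `f₂` is not isolated.
    obtain ⟨f₁, hf₁, hf₁₂, u, huf₂, huf₁⟩ : ∃ f₁ ∈ G.edges, f₁ ≠ f₂ ∧ ∃ u ∈ f₂, u ∈ f₁ := by
      by_contra! h
      refine hf₂e (hG.1.edge_of_closed hk (P := fun f => f = f₂) hf₂ rfl ?_ e he).symm
      rintro f hf g hg rfl x hxf hxg
      by_contra hgf
      exact h g hg hgf x hxf hxg
    have hf₁e : f₁ ≠ e := fun h => hdl (h ▸ huf₁) huf₂
    obtain ⟨v, hve, hvf⟩ := hall f₁ hf₁ hf₁e hf₁₂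
    have hv1 := one_le_degree_sub_one he hf₁ hf₁e.symm hve hvf
    -- The edge `f₁` meets `d_v - 1` edges at `v` and also `f₂`, but at most `m - 2` in all.
    have hvM : (G.degree v : ℝ) - 1 ≤ m - 3 := by
      have hsub : insert f₂ ((G.edges.erase f₁).filter (fun g => v ∈ g)) ⊆ G.meeting f₁ := by
        intro g hg
        rw [Finset.mem_insert, Finset.mem_filter, Finset.mem_erase] at hg
        rcases hg with rfl | ⟨⟨h1, h2⟩, h3⟩
        · exact mem_meeting.2 ⟨hf₁₂.symm, hf₂, u, huf₁, huf₂⟩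
        · exact mem_meeting.2 ⟨h1, h2, v, hvf, h3⟩
      have h3 := Finset.card_le_card hsub
      have hn : f₂ ∉ (G.edges.erase f₁).filter (fun g => v ∈ g) :=
        fun h => hdl hve (Finset.mem_filter.1 h).2
      rw [Finset.card_insert_of_notMem hn] at h3
      have h4 := hle2 f₁ hf₁
      have h5 : (((G.edges.erase f₁).filter (fun g => v ∈ g)).card : ℝ) + 3 ≤ m := by
        exact_mod_cast (by omega : ((G.edges.erase f₁).filter (fun g => v ∈ g)).card + 3 ≤ m)
      rw [G.degree_sub_one hf₁ hvf]
      linarith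
    have hs : ∑ i ∈ e, ((G.degree i : ℝ) - 1) = m - 2 := by
      rw [hG.sum_degree_sub_one he, ← hem]
      push_cast
      ring
    have hM45 : (m : ℝ) = 4 ∨ (5 : ℝ) ≤ m := by
      have : 4 ≤ m := by
        have : (4 : ℝ) ≤ m := by linarith
        exact_mod_cast this
      rcases this.eq_or_lt with h | h
      · exact Or.inl (by rw [← h]; norm_num)
      · exact Or.inr (by exact_mod_cast h)
    have hv12 : (G.degree v : ℝ) - 1 = 1 ∨ (2 : ℝ) ≤ (G.degree v : ℝ) - 1 := by
      have : 2 ≤ G.degree v := by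
        have : (2 : ℝ) ≤ G.degree v := by linarith
        exact_mod_cast this
      rcases this.eq_or_lt with h | h
      · exact Or.inl (by rw [← h]; norm_num)
      · have : (3 : ℝ) ≤ G.degree v := by exact_mod_cast h
        exact Or.inr (by linarith)
    have hle : ∀ i ∈ e, (G.degree i : ℝ) - 1 ≤ m - 2 := fun i hi =>
      hs ▸ Finset.single_le_sum (f := fun i => (G.degree i : ℝ) - 1)
        (fun j hj => (ha e he j hj).elim (fun h => h.ge) zero_le_one.trans) hi
    have key := lt_mul_prod_pendantFactor hM45 e (fun i => (G.degree i : ℝ) - 1) (ha e he) hs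
      hve hv12 hvM
    have hrw : 1 + ((G.degree v : ℝ) - 1) -
        ((G.degree v : ℝ) - 1 - 1) * ((G.degree v : ℝ) - 1) / secondRadius m -
        (1 + ((G.degree v : ℝ) - 1)) / (2 * secondRadius m - 1) =
        (G.degree v : ℝ) - ((G.degree v : ℝ) - 2) * ((G.degree v : ℝ) - 1) / secondRadius m -
        G.degree v / (2 * secondRadius m - 1) := by ring
    rw [hrw] at key
    exact hG.abcSpectralRadius_lt_of_twig hk he hf₁ hf₂ hd hve hvf huf₁ huf₂ hall
      (by rcases hM45 with h | h <;> linarith)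
      (fun i hi => pendantFactor_pos hM
        ((ha e he i hi).elim (fun h => h.ge) zero_le_one.trans) (hle i hi))
      key.1 (hs ▸ key.2)
  · push Not at h2
    -- Every edge now meets at most `m - 3` others, which is below `m - 5/2`.
    have hle3 : ∀ e ∈ G.edges, ((G.meeting e).card : ℝ) < secondRadius m := fun e he => by
      have h3 := hle2 e he
      have h4 := h2 e he
      have : ((G.meeting e).card : ℝ) + 3 ≤ m := by
        exact_mod_cast (by omega : (G.meeting e).card + 3 ≤ m)
      linarith
    have h3 := hG.abcSpectralRadius_le_of_card_meeting hk hr fun e he => (hle3 e he).le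
    refine lt_of_le_of_ne h3.1 fun heq => ?_
    obtain ⟨e, he⟩ : G.edges.Nonempty := Finset.card_pos.1 (by omega)
    exact (hle3 e he).ne (h3.2 heq e he)

theorem IsHypertree.secondRadius_le_abcSpectralRadius [Fintype V] [Nonempty V] (hk : 2 ≤ k)
    (hG : G.IsHypertree) {m : ℕ} (hm : 3 ≤ m) {e : Finset V} {i j : V}
    (h : G.IsDoubleStarAt m e i j) :
    secondRadius m ^ (1 / (k : ℝ)) ≤ G.abcSpectralRadius := by
  obtain ⟨he, hi, hj, hij, hi2, hjm, hl, hall⟩ := h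
  have hM : (3 : ℝ) ≤ m := by exact_mod_cast hm
  have hlr := lt_secondRadius hM
  have hr : 0 < secondRadius m := by linarith
  have hi1 : (G.degree i : ℝ) - 1 = 1 := by rw [hi2]; norm_num
  have hj1 : (G.degree j : ℝ) - 1 = m - 2 := by
    rw [← hjm]
    push_cast
    ring
  have hl1 : ∀ l ∈ e, l ≠ i → l ≠ j → (G.degree l : ℝ) - 1 = 0 := fun l h1 h2 h3 => by
    rw [hl l h1 h2 h3]
    norm_num
  have hji : j ∈ e.erase i := Finset.mem_erase.2 ⟨hij.symm, hj⟩
  have hl2 : ∀ l ∈ (e.erase i).erase j, (G.degree l : ℝ) - 1 = 0 := fun l hl => by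
    rw [Finset.mem_erase, Finset.mem_erase] at hl
    exact hl1 l hl.2.2 hl.2.1 hl.1
  refine hG.le_abcSpectralRadius_of_central hk he hall hr ?_ ?_
  · intro l hle
    by_cases hli : l = i
    · rw [hli, hi1]
      exact pendantFactor_pos hM zero_le_one (by linarith)
    by_cases hlj : l = j
    · rw [hlj, hj1]
      exact pendantFactor_pos hM (by linarith) le_rfl
    · rw [hl1 l hle hli hlj, pendantFactor_zero]
      exact one_pos
  · rw [← Finset.add_sum_erase _ _ hi, ← Finset.add_sum_erase _ _ hji, Finset.sum_eq_zero hl2,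
      ← Finset.mul_prod_erase _ _ hi, ← Finset.mul_prod_erase _ _ hji,
      Finset.prod_eq_one fun l hl => by rw [hl2 l hl, pendantFactor_zero], hi1, hj1, mul_one,
      pendantFactor_secondRadius hM]
    field_simp
    ring

end UniformHypergraph

/-! ### Isomorphism with the hyperstar and with the power of the double star -/

namespace UniformHypergraph

/-- The vertices outside a core that lie in exactly one edge are classified by that edge. -/
theorem exists_core_split {U ι I : Type*} [Fintype U] [DecidableEq U] [Fintype ι]
    [DecidableEq ι] [DecidableEq I] {k : ℕ}
    {L : UniformHypergraph U k} {c : I → Finset U} (hc : ∀ e, e ∈ L.edges ↔ ∃ j, c j = e)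
    {γ : ι → U} (hγ : Function.Injective γ)
    (hU : ∀ x, (∀ i, γ i ≠ x) → ∃ j, ∀ j', x ∈ c j' ↔ j' = j) :
    ∃ f : U → ι ⊕ I, (∀ x i, f x = Sum.inl i ↔ γ i = x) ∧
      (∀ x j, f x = Sum.inr j → ∀ j', x ∈ c j' ↔ j' = j) ∧
      ∀ j, Fintype.card {x // f x = Sum.inr j} +
        (Finset.univ.filter (fun i => γ i ∈ c j)).card = k := by
  have h : ∀ x, ∃ s : ι ⊕ I, (∀ i, s = Sum.inl i ↔ γ i = x) ∧
      ∀ j, s = Sum.inr j → ∀ j', x ∈ c j' ↔ j' = j := by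
    intro x
    by_cases hx : ∃ i, γ i = x
    · obtain ⟨i, rfl⟩ := hx
      refine ⟨Sum.inl i, fun i' => ?_, fun j h => by simp at h⟩
      rw [Sum.inl.injEq, hγ.eq_iff, eq_comm]
    · push Not at hx
      obtain ⟨j, hj⟩ := hU x hx
      refine ⟨Sum.inr j, fun i' => ?_, ?_⟩
      · simpa using hx i'
      · rintro j' hj'
        rw [Sum.inr.injEq] at hj'
        exact hj' ▸ hj
  choose f hf1 hf2 using h
  refine ⟨f, hf1, hf2, fun j => ?_⟩
  have hk := L.card_edge (c j) ((hc _).2 ⟨j, rfl⟩)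
  -- The `k` vertices of an edge split into those private to it and those in the core.
  rw [← Finset.card_filter_add_card_filter_not (s := c j) (fun x => f x = Sum.inr j)] at hk
  rw [← hk, Fintype.card_subtype]
  congr 1
  · congr 1
    ext x
    simp only [Finset.mem_filter, Finset.mem_univ, true_and]
    exact ⟨fun h => ⟨(hf2 x j h j).2 rfl, h⟩, fun h => h.2⟩
  · rw [← Finset.card_image_of_injective _ hγ]
    congr 1
    ext x
    simp only [Finset.mem_filter, Finset.mem_univ, true_and, Finset.mem_image]
    constructor
    · rintro ⟨i, hi, rfl⟩
      refine ⟨hi, ?_⟩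
      rw [(hf1 (γ i) i).2 rfl]
      simp
    · rintro ⟨hx, hxf⟩
      rcases hfx : f x with i | j'
      · have := (hf1 x i).1 hfx
        exact ⟨i, this ▸ hx, this⟩
      · rw [hfx] at hxf
        exact absurd (by rw [(hf2 x j' hfx j).1 hx]) hxf

/-- Two hypergraphs are isomorphic if their edges and some of their vertices can be matched so
that incidence is preserved and each of the other vertices lies in exactly one edge. -/
theorem isomorphic_of_core {V W ι I : Type*} [Fintype V] [Fintype W] [Fintype ι] {k : ℕ}
    {G : UniformHypergraph V k} {H : UniformHypergraph W k}
    {a : I → Finset V} {b : I → Finset W} (ha : ∀ e, e ∈ G.edges ↔ ∃ j, a j = e)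
    (hb : ∀ e, e ∈ H.edges ↔ ∃ j, b j = e) {α : ι → V} {β : ι → W}
    (hα : Function.Injective α) (hβ : Function.Injective β)
    (hinc : ∀ i j, α i ∈ a j ↔ β i ∈ b j)
    (hV : ∀ x, (∀ i, α i ≠ x) → ∃ j, ∀ j', x ∈ a j' ↔ j' = j)
    (hW : ∀ x, (∀ i, β i ≠ x) → ∃ j, ∀ j', x ∈ b j' ↔ j' = j) : G.Isomorphic H := by
  classical
  obtain ⟨f, hf1, hf2, hf3⟩ := exists_core_split ha hα hV
  obtain ⟨g, hg1, hg2, hg3⟩ := exists_core_split hb hβ hW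
  -- Core fibres are single points. The private fibres of matched edges have equal size, as both
  -- edges have `k` vertices and the same core incidences.
  have hfib : ∀ s, Nonempty ({x // f x = s} ≃ {y // g y = s}) := by
    rintro (i | j)
    · have e1 : Fintype.card {x // f x = Sum.inl i} = 1 := by
        rw [Fintype.card_eq_one_iff]
        refine ⟨⟨α i, (hf1 _ _).2 rfl⟩, fun y => Subtype.ext ((hf1 _ _).1 y.2).symm⟩
      have e2 : Fintype.card {x // g x = Sum.inl i} = 1 := by
        rw [Fintype.card_eq_one_iff]
        refine ⟨⟨β i, (hg1 _ _).2 rfl⟩, fun y => Subtype.ext ((hg1 _ _).1 y.2).symm⟩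
      exact Fintype.card_eq.1 (e1.trans e2.symm)
    · refine Fintype.card_eq.1 ?_
      have h1 := hf3 j
      have h2 := hg3 j
      simp only [hinc] at h1
      omega
  let φ : V ≃ W := Equiv.ofFiberEquiv (f := f) (g := g) fun s => (hfib s).some
  have hφ : ∀ x, g (φ x) = f x := fun x => Equiv.ofFiberEquiv_map _ x
  have hmem : ∀ x j, φ x ∈ b j ↔ x ∈ a j := by
    intro x j
    rcases hfx : f x with i | j'
    · have h1 := (hf1 x i).1 hfx
      have h2 := (hg1 (φ x) i).1 ((hφ x).trans hfx)
      rw [← h2, ← h1, hinc]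
    · rw [hf2 x j' hfx, hg2 (φ x) j' ((hφ x).trans hfx)]
  have hmap : ∀ j, (a j).map φ.toEmbedding = b j := by
    intro j
    ext y
    rw [Finset.mem_map_equiv, ← hmem, Equiv.apply_symm_apply]
  refine ⟨φ, fun e => ?_⟩
  rw [ha, hb]
  constructor
  · rintro ⟨j, hj⟩
    exact ⟨j, Finset.map_injective φ.toEmbedding ((hmap j).trans hj)⟩
  · rintro ⟨j, rfl⟩
    exact ⟨j, (hmap j).symm⟩

/-- An isomorphism carries a parametrization of the edges back. -/
theorem Isomorphic.exists_param {V W I : Type*} {k : ℕ} {G : UniformHypergraph V k}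
    {H : UniformHypergraph W k} (h : G.Isomorphic H) {b : I → Finset W}
    (hb : ∀ e, e ∈ H.edges ↔ ∃ j, b j = e) :
    ∃ (φ : V ≃ W) (a : I → Finset V), (∀ e, e ∈ G.edges ↔ ∃ j, a j = e) ∧
      ∀ x j, x ∈ a j ↔ φ x ∈ b j := by
  obtain ⟨φ, hφ⟩ := h
  refine ⟨φ, fun j => (b j).map φ.symm.toEmbedding, fun e => ?_, fun x j => ?_⟩
  · rw [← hφ, hb]
    refine exists_congr fun j => ?_
    constructor
    · intro h
      change (b j).map _ = e
      rw [h]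
      ext x
      simp
    · rintro rfl
      ext y
      simp
  · rw [Finset.mem_map_equiv, Equiv.symm_symm]

theorem degree_eq_card_filter {V I : Type*} [DecidableEq V] [Fintype I] {k : ℕ}
    {G : UniformHypergraph V k} {a : I → Finset V} (hinj : Function.Injective a)
    (ha : ∀ e, e ∈ G.edges ↔ ∃ j, a j = e) (x : V) :
    G.degree x = (Finset.univ.filter (fun j => x ∈ a j)).card := by
  rw [degree, ← Finset.card_image_of_injective _ hinj]
  congr 1
  ext e
  simp only [Finset.mem_filter, Finset.mem_image, Finset.mem_univ, true_and, ha]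
  constructor
  · rintro ⟨⟨j, rfl⟩, hx⟩
    exact ⟨j, hx, rfl⟩
  · rintro ⟨j, hx, rfl⟩
    exact ⟨⟨j, rfl⟩, hx⟩

theorem mem_hyperstar {m k : ℕ} (hk : 1 ≤ k) (e : Finset (Option (Fin m × Fin (k - 1)))) :
    e ∈ (hyperstar m k hk).edges ↔ ∃ j, starEdge m k j = e := by
  simp [hyperstar]

theorem some_mem_starEdge {m k : ℕ} (j j' : Fin m) (l : Fin (k - 1)) :
    some (j, l) ∈ starEdge m k j' ↔ j' = j := by
  simp [starEdge]

theorem none_mem_starEdge {m k : ℕ} (j : Fin m) : none ∈ starEdge m k j :=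
  Finset.mem_insert_self _ _

/-- A hypertree is a hyperstar if and only if its edges have a vertex in common. -/
theorem IsHypertree.isomorphic_hyperstar_iff {V : Type*} [Fintype V] [DecidableEq V] {k m : ℕ}
    (hk : 2 ≤ k) (hm : 1 ≤ m) {G : UniformHypergraph V k} (hG : G.IsHypertree)
    (hsize : G.edges.card = m) :
    G.Isomorphic (hyperstar m k (one_le_two.trans hk)) ↔ ∃ c, ∀ e ∈ G.edges, c ∈ e := by
  constructor
  · intro h
    obtain ⟨φ, a, ha, hφ⟩ := h.exists_param (mem_hyperstar _)
    refine ⟨φ.symm none, fun e he => ?_⟩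
    obtain ⟨j, rfl⟩ := (ha e).1 he
    rw [hφ, Equiv.apply_symm_apply]
    exact none_mem_starEdge j
  · rintro ⟨c, hc⟩
    let E := Finset.equivFinOfCardEq hsize
    have hE : ∀ e, e ∈ G.edges ↔ ∃ j, (E.symm j : Finset V) = e := fun e =>
      ⟨fun he => ⟨E ⟨e, he⟩, by simp⟩, fun ⟨j, hj⟩ => hj ▸ (E.symm j).2⟩
    -- The core is the centre; by linearity any other vertex lies in only one edge.
    refine isomorphic_of_core (ι := Unit) (α := fun _ => c) (β := fun _ => none) hE
      (mem_hyperstar _) (fun _ _ _ => rfl) (fun _ _ _ => rfl) (fun _ j => ?_) (fun x hx => ?_)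
      (fun x hx => ?_)
    · simp only [none_mem_starEdge, iff_true]
      exact hc _ (E.symm j).2
    · obtain ⟨e, he, hxe⟩ := hG.1.exists_edge hk (Finset.card_pos.1 (hsize ▸ hm)) x
      refine ⟨E ⟨e, he⟩, fun j => ⟨fun hj => ?_, ?_⟩⟩
      · by_contra hne
        have : (E.symm j : Finset V) ≠ e := by
          intro h
          exact hne (by rw [← E.apply_symm_apply j]; exact congrArg E (Subtype.ext h))
        exact hx () (hG.linear (E.symm j).2 he this (hc _ (E.symm j).2) (hc e he) hj hxe)
      · rintro rfl
        simpa using hxe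
    · rcases x with _ | ⟨j, l⟩
      · exact absurd rfl (hx ())
      · exact ⟨j, fun j' => some_mem_starEdge j j' l⟩

/-- The edges of the double star `D_{m,1}`: the edge between the centers, the other edge at the
first center, and the other edges at the second center. -/
def doubleStarEdge (m : ℕ) : Option (Option (Fin (m - 1 - 1))) →
    Finset (Option (Fin 1 × Fin (2 - 1)) ⊕ Option (Fin (m - 1 - 1) × Fin (2 - 1)))
  | none => {Sum.inl none, Sum.inr none}
  | some none => (starEdge 1 2 0).map Function.Embedding.inl
  | some (some j) => (starEdge (m - 1 - 1) 2 j).map Function.Embedding.inr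

theorem mem_doubleStar {m : ℕ} (e) :
    e ∈ (doubleStar m 1).edges ↔ ∃ o, doubleStarEdge m o = e := by
  simp only [doubleStar, Finset.mem_union, Finset.mem_image, mem_hyperstar,
    Finset.mem_singleton, Option.exists, doubleStarEdge, eq_comm (b := e)]
  constructor
  · rintro ((⟨f, ⟨j, rfl⟩, rfl⟩ | ⟨f, ⟨j, rfl⟩, rfl⟩) | rfl)
    · exact Or.inr (Or.inl (by rw [Subsingleton.elim j 0]))
    · exact Or.inr (Or.inr ⟨j, rfl⟩)
    · exact Or.inl rfl
  · rintro (rfl | rfl | ⟨j, rfl⟩)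
    · exact Or.inr rfl
    · exact Or.inl (Or.inl ⟨_, ⟨0, rfl⟩, rfl⟩)
    · exact Or.inl (Or.inr ⟨_, ⟨j, rfl⟩, rfl⟩)

theorem inl_none_mem_doubleStarEdge {m : ℕ} (o) :
    Sum.inl none ∈ doubleStarEdge m o ↔ o = none ∨ o = some none := by
  rcases o with _ | _ | j
  · simp [doubleStarEdge]
  · refine iff_of_true ?_ (Or.inr rfl)
    exact Finset.mem_map_of_mem _ (none_mem_starEdge _)
  · simp [doubleStarEdge]

theorem inr_none_mem_doubleStarEdge {m : ℕ} (o) :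
    Sum.inr none ∈ doubleStarEdge m o ↔ o ≠ some none := by
  rcases o with _ | _ | j
  · simp [doubleStarEdge]
  · simp [doubleStarEdge]
  · refine iff_of_true ?_ (by simp)
    exact Finset.mem_map_of_mem _ (none_mem_starEdge _)

theorem inl_some_mem_doubleStarEdge {m : ℕ} (p) (o) :
    Sum.inl (some p) ∈ doubleStarEdge m o ↔ o = some none := by
  obtain ⟨p, l⟩ := p
  rcases o with _ | _ | j
  · simp [doubleStarEdge]
  · refine iff_of_true ?_ rfl
    exact Finset.mem_map_of_mem _ ((some_mem_starEdge _ _ _).2 (Subsingleton.elim _ _))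
  · simp [doubleStarEdge]

theorem inr_some_mem_doubleStarEdge {m : ℕ} (p) (o) :
    Sum.inr (some p) ∈ doubleStarEdge m o ↔ o = some (some p.1) := by
  obtain ⟨p, l⟩ := p
  rcases o with _ | _ | j
  · simp [doubleStarEdge]
  · simp [doubleStarEdge]
  · rw [Option.some_inj, Option.some_inj, ← some_mem_starEdge (k := 2) p j l]
    exact Finset.mem_map' Function.Embedding.inr

/-- The edges of the power of the double star. -/
def powerDoubleStarEdge (m k : ℕ) (o : Option (Option (Fin (m - 1 - 1)))) :=
  (doubleStar m 1).powerEdge k ⟨doubleStarEdge m o, (mem_doubleStar _).2 ⟨o, rfl⟩⟩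

theorem mem_power_doubleStar {m k : ℕ} (hk : 2 ≤ k) (e) :
    e ∈ ((doubleStar m 1).power k hk).edges ↔ ∃ o, powerDoubleStarEdge m k o = e := by
  simp only [power, Finset.mem_image, Finset.mem_univ, true_and, powerDoubleStarEdge]
  constructor
  · rintro ⟨⟨f, hf⟩, rfl⟩
    obtain ⟨o, rfl⟩ := (mem_doubleStar f).1 hf
    exact ⟨o, rfl⟩
  · rintro ⟨o, rfl⟩
    exact ⟨_, rfl⟩

theorem inl_mem_powerDoubleStarEdge {m k : ℕ} (x) (o) :
    Sum.inl x ∈ powerDoubleStarEdge m k o ↔ x ∈ doubleStarEdge m o := by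
  simp [powerDoubleStarEdge, powerEdge]

theorem inr_mem_powerDoubleStarEdge {m k : ℕ} (p) (o) :
    Sum.inr p ∈ powerDoubleStarEdge m k o ↔ doubleStarEdge m o = p.1.1 := by
  obtain ⟨⟨f, hf⟩, l⟩ := p
  rw [powerDoubleStarEdge, powerEdge, Finset.inr_mem_disjSum, Finset.mem_map]
  constructor
  · rintro ⟨l', -, h⟩
    exact congrArg (fun q => q.1.1) h
  · rintro rfl
    exact ⟨l, Finset.mem_univ _, rfl⟩

theorem doubleStarEdge_injective (m : ℕ) : Function.Injective (doubleStarEdge m) := by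
  intro o o' h
  have h1 := inl_none_mem_doubleStarEdge (m := m) o
  have h2 := inr_none_mem_doubleStarEdge (m := m) o
  rw [h, inl_none_mem_doubleStarEdge] at h1
  rw [h, inr_none_mem_doubleStarEdge] at h2
  rcases o with _ | _ | j
  · exact ((h1.2 (Or.inl rfl)).resolve_right (h2.2 (by simp))).symm
  · exact (by simpa using h2 : o' = some none).symm
  · have h3 := (inr_some_mem_doubleStarEdge (m := m) (j, 0) (some (some j))).2 rfl
    rw [h, inr_some_mem_doubleStarEdge] at h3
    exact h3.symm

theorem powerDoubleStarEdge_injective (m k : ℕ) :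
    Function.Injective (powerDoubleStarEdge m k) := by
  intro o o' h
  apply doubleStarEdge_injective m
  ext x
  rw [← inl_mem_powerDoubleStarEdge (k := k), h, inl_mem_powerDoubleStarEdge]

/-- Every vertex of the power of the double star other than the two centers lies in exactly one
edge. -/
theorem exists_powerDoubleStarEdge {m k : ℕ} (x) (h1 : x ≠ Sum.inl (Sum.inl none))
    (h2 : x ≠ Sum.inl (Sum.inr none)) :
    ∃ o, ∀ o', x ∈ powerDoubleStarEdge m k o' ↔ o' = o := by
  rcases x with ((_ | p) | (_ | p)) | ⟨⟨f, hf⟩, l⟩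
  · exact absurd rfl h1
  · refine ⟨some none, fun o' => ?_⟩
    rw [inl_mem_powerDoubleStarEdge, inl_some_mem_doubleStarEdge]
  · exact absurd rfl h2
  · refine ⟨some (some p.1), fun o' => ?_⟩
    rw [inl_mem_powerDoubleStarEdge, inr_some_mem_doubleStarEdge]
  · obtain ⟨o, rfl⟩ := (mem_doubleStar f).1 hf
    refine ⟨o, fun o' => ?_⟩
    rw [inr_mem_powerDoubleStarEdge, (doubleStarEdge_injective m).eq_iff]

theorem exists_isDoubleStarAt_of_isomorphic {V : Type*} [DecidableEq V] {k m : ℕ}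
    (hk : 2 ≤ k) (hm : 3 ≤ m) {G : UniformHypergraph V k}
    (h : G.Isomorphic ((doubleStar m 1).power k hk)) : ∃ e i j, G.IsDoubleStarAt m e i j := by
  obtain ⟨φ, a, ha, hφ⟩ := h.exists_param (mem_power_doubleStar hk)
  have hinj : Function.Injective a := by
    intro o o' h
    apply powerDoubleStarEdge_injective m k
    ext y
    rw [← φ.apply_symm_apply y, ← hφ, ← hφ, h]
  have hi : ∀ o, φ.symm (Sum.inl (Sum.inl none)) ∈ a o ↔ o = none ∨ o = some none := fun o => by
    rw [hφ, Equiv.apply_symm_apply, inl_mem_powerDoubleStarEdge, inl_none_mem_doubleStarEdge]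
  have hj : ∀ o, φ.symm (Sum.inl (Sum.inr none)) ∈ a o ↔ o ≠ some none := fun o => by
    rw [hφ, Equiv.apply_symm_apply, inl_mem_powerDoubleStarEdge, inr_none_mem_doubleStarEdge]
  refine ⟨a none, φ.symm (Sum.inl (Sum.inl none)), φ.symm (Sum.inl (Sum.inr none)),
    (ha _).2 ⟨none, rfl⟩, (hi _).2 (Or.inl rfl), (hj _).2 (by simp), ?_, ?_, ?_, ?_, ?_⟩
  · intro h
    simpa using φ.symm.injective h
  · rw [degree_eq_card_filter hinj ha]
    have : Finset.univ.filter (fun o => φ.symm (Sum.inl (Sum.inl none)) ∈ a o) =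
        {none, some none} := by
      ext o
      simp [hi]
    rw [this, Finset.card_pair (by simp)]
  · rw [degree_eq_card_filter hinj ha]
    have : Finset.univ.filter (fun o => φ.symm (Sum.inl (Sum.inr none)) ∈ a o) =
        Finset.univ.erase (some none) := by
      ext o
      simp [hj]
    rw [this, Finset.card_erase_add_one (Finset.mem_univ _), Finset.card_univ,
      Fintype.card_option, Fintype.card_option, Fintype.card_fin]
    omega
  · intro l _ h1 h2
    obtain ⟨o, ho⟩ := exists_powerDoubleStarEdge (m := m) (k := k) (φ l)
      (fun h => h1 (by rw [← h, Equiv.symm_apply_apply]))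
      (fun h => h2 (by rw [← h, Equiv.symm_apply_apply]))
    rw [degree_eq_card_filter hinj ha]
    have : Finset.univ.filter (fun o => l ∈ a o) = {o} := by
      ext o'
      simp [hφ, ho]
    rw [this, Finset.card_singleton]
  · intro f hf _
    obtain ⟨o, rfl⟩ := (ha f).1 hf
    by_cases ho : o = some none
    · exact ⟨_, (hi none).2 (Or.inl rfl), (hi o).2 (Or.inr ho)⟩
    · exact ⟨_, (hj none).2 (by simp), (hj o).2 ho⟩

theorem IsHypertree.isomorphic_of_isDoubleStarAt {V : Type*} [Fintype V] [DecidableEq V]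
    {k m : ℕ} (hk : 2 ≤ k) (hm : 3 ≤ m) {G : UniformHypergraph V k} (hG : G.IsHypertree)
    (hsize : G.edges.card = m) {e : Finset V} {i j : V} (h : G.IsDoubleStarAt m e i j) :
    G.Isomorphic ((doubleStar m 1).power k hk) := by
  obtain ⟨he, hi, hj, hij, hi2, hjm, hl, hall⟩ := h
  have hc : ((G.edges.filter (fun f => i ∈ f)).erase e).card = 1 := by
    rw [Finset.card_erase_of_mem (Finset.mem_filter.2 ⟨he, hi⟩)]
    change G.degree i - 1 = 1
    omega
  obtain ⟨f₁, hf₁s⟩ := Finset.card_eq_one.1 hc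
  have hmem : ∀ f, f ≠ e ∧ f ∈ G.edges ∧ i ∈ f ↔ f = f₁ := fun f => by
    rw [← Finset.mem_singleton, ← hf₁s, Finset.mem_erase, Finset.mem_filter]
  obtain ⟨hf₁e, hf₁, hif₁⟩ := (hmem f₁).2 rfl
  have hjf₁ : j ∉ f₁ := fun h => hij (hG.linear he hf₁ hf₁e.symm hi hif₁ hj h)
  -- By linearity `f₁` avoids `j`, and the degree `m - 1` of `j` leaves room for no other exception.
  have hjeq : G.edges.filter (fun f => j ∈ f) = G.edges.erase f₁ := by
    refine Finset.eq_of_subset_of_card_le (fun f hf => ?_) ?_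
    · obtain ⟨hf, hjf⟩ := Finset.mem_filter.1 hf
      exact Finset.mem_erase.2 ⟨fun h => hjf₁ (h ▸ hjf), hf⟩
    · rw [Finset.card_erase_of_mem hf₁]
      change _ ≤ G.degree j
      omega
  have hjf : ∀ f ∈ G.edges, j ∈ f ↔ f ≠ f₁ := by
    intro f hf
    have : f ∈ G.edges.filter (fun f => j ∈ f) ↔ f ∈ G.edges.erase f₁ := by rw [hjeq]
    simpa [hf] using this
  have hrest : ((G.edges.erase e).erase f₁).card = m - 1 - 1 := by
    rw [Finset.card_erase_of_mem (Finset.mem_erase.2 ⟨hf₁e, hf₁⟩), Finset.card_erase_of_mem he,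
      hsize]
  let E := Finset.equivFinOfCardEq hrest
  let a : Option (Option (Fin (m - 1 - 1))) → Finset V := fun o =>
    match o with
    | none => e
    | some none => f₁
    | some (some l) => E.symm l
  have hE : ∀ l, (E.symm l : Finset V) ≠ f₁ ∧ (E.symm l : Finset V) ≠ e ∧
      (E.symm l : Finset V) ∈ G.edges := fun l => by
    have h := Finset.mem_erase.1 (E.symm l).2
    exact ⟨h.1, Finset.mem_erase.1 h.2⟩
  have ha : ∀ f, f ∈ G.edges ↔ ∃ o, a o = f := by
    intro f
    constructor
    · intro hf
      by_cases h1 : f = e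
      · exact ⟨none, h1.symm⟩
      by_cases h2 : f = f₁
      · exact ⟨some none, h2.symm⟩
      · exact ⟨some (some (E ⟨f, Finset.mem_erase.2 ⟨h2, Finset.mem_erase.2 ⟨h1, hf⟩⟩⟩)),
          by simp [a]⟩
    · rintro ⟨_ | _ | l, rfl⟩
      · exact he
      · exact hf₁
      · exact (hE l).2.2
  have hinj : Function.Injective a := by
    rintro (_ | _ | l) (_ | _ | l') h
    · rfl
    · exact absurd h.symm hf₁e
    · exact absurd h.symm (hE l').2.1
    · exact absurd h hf₁e
    · rfl
    · exact absurd h.symm (hE l').1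
    · exact absurd h (hE l).2.1
    · exact absurd h (hE l).1
    · have : E.symm l = E.symm l' := Subtype.ext h
      rw [E.symm.injective this]
  -- The core consists of the two centres: `true` is the one of degree 2, `false` the one of degree
  -- `m - 1`.
  refine isomorphic_of_core (ι := Bool) (α := fun b => if b then i else j)
    (β := fun b => Sum.inl (if b then Sum.inl none else Sum.inr none)) ha
    (mem_power_doubleStar hk) ?_ ?_ ?_ ?_ ?_
  · rintro (_ | _) (_ | _) h <;> simp_all
  · rintro (_ | _) (_ | _) h <;> simp_all
  · rintro (_ | _) o
    · simp only [Bool.false_eq_true, if_false]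
      rw [inl_mem_powerDoubleStarEdge, inr_none_mem_doubleStarEdge, hjf _ ((ha _).2 ⟨o, rfl⟩),
        not_iff_not]
      exact hinj.eq_iff (b := some none)
    · simp only [if_true]
      rw [inl_mem_powerDoubleStarEdge, inl_none_mem_doubleStarEdge, ← hinj.eq_iff,
        ← hinj.eq_iff (b := some none)]
      change _ ↔ a o = e ∨ a o = f₁
      rw [← hmem]
      constructor
      · intro h
        by_cases h1 : a o = e
        · exact Or.inl h1
        · exact Or.inr ⟨h1, (ha _).2 ⟨o, rfl⟩, h⟩
      · rintro (h | h)
        · exact h ▸ hi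
        · exact h.2.2
  · intro x hx
    have hxi : x ≠ i := fun h => hx true h.symm
    have hxj : x ≠ j := fun h => hx false h.symm
    obtain ⟨f, hf, hxf⟩ := hG.1.exists_edge hk ⟨e, he⟩ x
    obtain ⟨o, rfl⟩ := (ha f).1 hf
    refine ⟨o, fun o' => ⟨fun hxo => ?_, fun h => h ▸ hxf⟩⟩
    apply hinj
    have hf' := (ha _).2 ⟨o', rfl⟩
    -- On `e` the degree condition gives uniqueness; outside `e`, two edges through `x` would form a
    -- triangle with `e`.
    by_cases hxe : x ∈ e
    · have h1 := hl x hxe hxi hxj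
      rw [degree, Finset.card_eq_one] at h1
      obtain ⟨g, hg⟩ := h1
      have h2 : ∀ f ∈ G.edges, x ∈ f → f = g := fun f hf hxf =>
        Finset.mem_singleton.1 (hg ▸ Finset.mem_filter.2 ⟨hf, hxf⟩)
      rw [h2 _ hf hxf, h2 _ hf' hxo]
    · by_contra hne
      have n1 : a o' ≠ e := fun h => hxe (h ▸ hxo)
      have n2 : a o ≠ e := fun h => hxe (h ▸ hxf)
      obtain ⟨p, hpe, hp⟩ := hall _ hf n2
      obtain ⟨q, hqe, hq⟩ := hall _ hf' n1
      exact hxe (hG.triangle he hf hf' n2.symm (Ne.symm hne) n1 hpe hp hxf hxo hq hqe ▸ hpe)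
  · intro x hx
    exact exists_powerDoubleStarEdge x (fun h => hx true h.symm) (fun h => hx false h.symm)

end UniformHypergraph

/-! ### The first bound and the conclusion -/

namespace UniformHypergraph

/-- All edges meet pairwise. Two of them meet in `c`, and the absence of triangles forces every
third edge through `c`. -/
theorem IsHypertree.exists_common_of_card_meeting {V : Type*} [DecidableEq V] {k m : ℕ}
    {G : UniformHypergraph V k} (hG : G.IsHypertree) (hm : 2 ≤ m) (hsize : G.edges.card = m)
    (h : ∀ e ∈ G.edges, (G.meeting e).card + 1 = m) : ∃ c, ∀ e ∈ G.edges, c ∈ e := by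
  obtain ⟨e, he, f, hf, hef⟩ := Finset.one_lt_card.1 (by omega : 1 < G.edges.card)
  have hmeet := fun e he => meets_of_card_meeting he ((h e he).trans hsize.symm)
  obtain ⟨c, hce, hcf⟩ := hmeet e he f hf hef.symm
  refine ⟨c, fun g hg => ?_⟩
  by_cases hge : g = e
  · exact hge ▸ hce
  by_cases hgf : g = f
  · exact hgf ▸ hcf
  obtain ⟨y, hyf, hyg⟩ := hmeet f hf g hg hgf
  obtain ⟨z, hze, hzg⟩ := hmeet e he g hg hge
  exact hG.triangle he hf hg hef (Ne.symm hgf) hge hce hcf hyf hyg hzg hze ▸ hyg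

theorem card_meeting_of_common {V : Type*} [DecidableEq V] {k : ℕ} {G : UniformHypergraph V k}
    {c : V} (hc : ∀ e ∈ G.edges, c ∈ e) {e : Finset V} (he : e ∈ G.edges) :
    (G.meeting e).card + 1 = G.edges.card := by
  have : G.meeting e = G.edges.erase e := by
    refine Finset.filter_true_of_mem fun f hf => ?_
    exact Finset.not_disjoint_iff.2 ⟨c, hc e he, hc f (Finset.mem_of_mem_erase hf)⟩
  rw [this, Finset.card_erase_add_one he]

theorem IsHypertree.exists_common_of_card_le_two {V : Type*} [DecidableEq V] {k : ℕ}
    (hk : 2 ≤ k) {G : UniformHypergraph V k} (hG : G.IsHypertree) (h1 : 1 ≤ G.edges.card)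
    (h2 : G.edges.card ≤ 2) : ∃ c, ∀ e ∈ G.edges, c ∈ e := by
  obtain ⟨e, he⟩ := Finset.card_pos.1 h1
  by_cases h : ∃ f ∈ G.edges, f ≠ e ∧ ∃ c ∈ e, c ∈ f
  · obtain ⟨f, hf, hfe, c, hce, hcf⟩ := h
    refine ⟨c, fun g hg => ?_⟩
    have hs : {e, f} = G.edges := by
      refine Finset.eq_of_subset_of_card_le ?_ (h2.trans (Finset.card_pair hfe.symm).ge)
      intro g hg
      rcases Finset.mem_insert.1 hg with rfl | hg
      · exact he
      · exact Finset.mem_singleton.1 hg ▸ hf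
    rw [← hs, Finset.mem_insert, Finset.mem_singleton] at hg
    rcases hg with rfl | rfl
    · exact hce
    · exact hcf
  · push Not at h
    obtain ⟨c, hc⟩ : e.Nonempty := by
      rw [← Finset.card_pos, G.card_edge e he]
      omega
    refine ⟨c, fun g hg => ?_⟩
    have : g = e := by
      refine hG.1.edge_of_closed hk (P := fun g => g = e) he rfl ?_ g hg
      rintro g hg f hf rfl x hxe hxf
      by_contra hfe
      exact h f hf hfe x hxe hxf
    exact this ▸ hc

theorem IsHypertree.abcSpectralRadius_le_sub_one {V : Type*} [Fintype V] [DecidableEq V]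
    [Nonempty V] {k m : ℕ} (hk : 2 ≤ k) (hm : 1 ≤ m) {G : UniformHypergraph V k}
    (hG : G.IsHypertree) (hsize : G.edges.card = m) :
    G.abcSpectralRadius ≤ ((m : ℝ) - 1) ^ (1 / (k : ℝ)) ∧
      (G.abcSpectralRadius = ((m : ℝ) - 1) ^ (1 / (k : ℝ)) ↔ ∃ c, ∀ e ∈ G.edges, c ∈ e) := by
  have hk0 : k ≠ 0 := by omega
  have hm1 : (1 : ℝ) ≤ m := by exact_mod_cast hm
  have hle : ∀ e ∈ G.edges, ((G.meeting e).card : ℝ) ≤ m - 1 := fun e he => by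
    have : ((G.meeting e).card : ℝ) + 1 ≤ m := by exact_mod_cast hsize ▸ card_meeting_lt he
    linarith
  have hupper : G.abcSpectralRadius ≤ ((m : ℝ) - 1) ^ (1 / (k : ℝ)) ∧
      (G.abcSpectralRadius = ((m : ℝ) - 1) ^ (1 / (k : ℝ)) → ∃ c, ∀ e ∈ G.edges, c ∈ e) := by
    rcases hm.eq_or_lt with rfl | hm2
    · refine ⟨?_, fun _ => hG.exists_common_of_card_le_two hk hsize.ge (by omega)⟩
      have hz : (((1 : ℕ) : ℝ) - 1) ^ (1 / (k : ℝ)) = 0 := by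
        rw [Nat.cast_one, sub_self, Real.zero_rpow (by positivity)]
      rw [hz]
      -- For `m = 1` the bound is `0`, while labellings need `r > 0`; so `r = ε ^ k` is used for
      -- every `ε > 0`.
      refine le_of_forall_pos_le_add fun ε hε => ?_
      have h := (hG.abcSpectralRadius_le_of_card_meeting hk (pow_pos hε k) fun e he =>
        (hle e he).trans (by rw [Nat.cast_one, sub_self]; positivity)).1
      rwa [one_div, Real.pow_rpow_inv_natCast hε.le hk0, ← zero_add ε] at h
    · have hm2' : (2 : ℝ) ≤ m := by exact_mod_cast hm2
      have h := hG.abcSpectralRadius_le_of_card_meeting hk (by linarith : (0 : ℝ) < m - 1) hle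
      refine ⟨h.1, fun heq => hG.exists_common_of_card_meeting hm2 hsize fun e he => ?_⟩
      have : ((G.meeting e).card : ℝ) + 1 = m := by linarith [h.2 heq e he]
      exact_mod_cast this
  refine ⟨hupper.1, hupper.2, ?_⟩
  rintro ⟨c, hc⟩
  refine le_antisymm hupper.1 ?_
  refine hG.le_abcSpectralRadius_of_card_meeting hk (Finset.card_pos.1 (by omega))
    (by linarith) fun e he => ?_
  rw [← hsize, ← card_meeting_of_common hc he]
  push_cast
  ring

end UniformHypergraph

theorem mainTheorem2 {V : Type*} [Fintype V] [DecidableEq V] (k m : ℕ) (hk : 2 ≤ k) (hm : 1 ≤ m)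
    (G : UniformHypergraph V k) (hG : G.IsHypertree) (hsize : G.size = m) :
    (G.abcSpectralRadius ≤ ((m : ℝ) - 1) ^ (1 / (k : ℝ)) ∧
      (G.abcSpectralRadius = ((m : ℝ) - 1) ^ (1 / (k : ℝ)) ↔
        G.Isomorphic (UniformHypergraph.hyperstar m k (one_le_two.trans hk)))) ∧
    (¬ G.Isomorphic (UniformHypergraph.hyperstar m k (one_le_two.trans hk)) →
      G.abcSpectralRadius ≤
        (((m : ℝ) ^ 2 - 3 * m + 3 + √(((m : ℝ) - 1) ^ 2 + ((m : ℝ) - 2) ^ 4)) /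
          (2 * ((m : ℝ) - 1))) ^ (1 / (k : ℝ)) ∧
      (G.abcSpectralRadius =
        (((m : ℝ) ^ 2 - 3 * m + 3 + √(((m : ℝ) - 1) ^ 2 + ((m : ℝ) - 2) ^ 4)) /
          (2 * ((m : ℝ) - 1))) ^ (1 / (k : ℝ)) ↔
        G.Isomorphic ((UniformHypergraph.doubleStar m 1).power k hk))) := by
  have hsize : G.edges.card = m := hsize
  have : Nonempty V := by
    obtain ⟨e, he⟩ := Finset.card_pos.1 (by omega : 0 < G.edges.card)
    obtain ⟨x, -⟩ : e.Nonempty := by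
      rw [← Finset.card_pos, G.card_edge e he]
      omega
    exact ⟨x⟩
  rw [hG.isomorphic_hyperstar_iff hk hm hsize]
  refine ⟨hG.abcSpectralRadius_le_sub_one hk hm hsize, fun hns => ?_⟩
  -- With at most two edges connectedness already produces a common vertex.
  have hm3 : 3 ≤ m := by
    by_contra h
    exact hns (hG.exists_common_of_card_le_two hk (by omega) (by omega))
  have h := hG.abcSpectralRadius_le_secondRadius hk hm3 hsize hns
  refine ⟨h.1, fun heq => ?_, fun hiso => ?_⟩
  · obtain ⟨e, i, j, hD⟩ := h.2 heq
    exact hG.isomorphic_of_isDoubleStarAt hk hm3 hsize hD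
  · obtain ⟨e, i, j, hD⟩ := UniformHypergraph.exists_isDoubleStarAt_of_isomorphic hk hm3 hiso
    exact le_antisymm h.1 (hG.secondRadius_le_abcSpectralRadius hk hm3 hD)
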